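/- Let $K$ be a field. All operads are unital symmetric operads in graded $K$-vector spaces, a chain operad is such an operad with a differential $\partial$ of degree $-1$ ($\partial^2=0$) satisfying the Leibniz rule, $\langle M\rangle$ is the free graded operad on a graded $\Sigma$-module $M$, $U$ is the functor taking an operad to its underlying graded $\Sigma$-module, and $\mathrm{ch}$ is the left adjoint of the forgetful functor from chain operads to graded operads. Given a graded $\Sigma$-module $G$, a chain operad $Q$ and a map of graded $\Sigma$-modules $\varphi\colon s^{-1}G\to UQ$, the universal linking operad $\mathrm{lu}_\varphi(\langle G\rangle,Q)$ is the pushout, in chain operads, of $$Q\longleftarrow \mathrm{ch}\langle s^{-1}G\rangle\longrightarrow \mathrm{ch}\langle G\rangle ,$$ where the left map is induced by $\varphi$ and the right map sends a generator $s^{-1}x$ to $\partial x$. Let $M_0,M_1,M_2,\dots$ be graded $\Sigma$-modules. Put $L_0=\langle M_0\rangle$ with zero differential and, for maps of graded $\Sigma$-modules $\varphi_j\colon s^{-1}M_{j+1}\to UL_j$ ($j\ge 0$), put $L_{j+1}=\mathrm{lu}_{\varphi_j}(\langle M_{j+1}\rangle,L_j)$. The link operad $\mathrm{link}(\langle M_0\rangle,\langle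 M_1\rangle,\dots)$ is the colimit of $L_0\to L_1\to L_2\to\cdots$ in chain operads. Assume that 1. every $\varphi_j$ takes values in cycles, $\partial\circ\varphi_j=0$; 2. no $\varphi_j$ takes the operadic identity as a value (this is automatic if $M_j(1)=0$ for all $j\ge 1$); 3. for all $i<j$, $\max\operatorname{arity}(M_i)<\min\operatorname{arity}(M_j)$, that is, $a<b$ whenever $M_i(a)\neq 0$ and $M_j(b)\ne 0$. Then $L=\mathrm{link}(\langle M_0\rangle,\langle M_1\rangle,\dots)$ is a minimal operad. That is, there are graded $\Sigma$-modules $E_0,E_1,\dots$ and maps $E_k\to UL$ such that, with $E=\bigoplus_k E_k$, the induced morphism $\langle E\rangle\to L$ is an isomorphism of graded operads; the differential is decomposable, i.e. $\partial E$ lies in the span of the composition trees with at least two nodes in $E$; and for every $k$, $\partial E_k$ lies in the suboperad generated by $\bigoplus_{i<k}E_i$. -/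

import Mathlib

open CategoryTheory CategoryTheory.Limits

universe u

/-! ## Graded Σ-modules

`obj n p` is the component of arity `n` and degree `p`. The action of the symmetric groups is
recorded for all bijections `Fin m ≃ Fin n` (which exist only for `m = n`), covariantly. -/

/-- A graded `Σ`-module over the field `K`. -/
structure SigmaModule (K : Type u) [Field K] where
  /-- the component of given arity and degree -/
  obj : ℕ → ℤ → Type u
  [addCommGroup : ∀ n p, AddCommGroup (obj n p)]
  [module : ∀ n p, Module K (obj n p)]
  /-- the action of the symmetric groups -/
  act : ∀ {m n : ℕ} {p : ℤ}, (Fin m ≃ Fin n) → (obj m p →ₗ[K] obj n p)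
  act_refl : ∀ {n : ℕ} {p : ℤ} (x : obj n p), act (Equiv.refl (Fin n)) x = x
  act_trans : ∀ {l m n : ℕ} {p : ℤ} (σ : Fin l ≃ Fin m) (τ : Fin m ≃ Fin n) (x : obj l p),
    act (σ.trans τ) x = act τ (act σ x)

attribute [instance] SigmaModule.addCommGroup SigmaModule.module

/-- Degree-preserving equivariant linear maps. -/
@[ext]
structure SigmaModule.Hom {K : Type u} [Field K] (M N : SigmaModule K) where
  /-- the linear map in each arity and degree -/
  app : ∀ (n : ℕ) (p : ℤ), M.obj n p →ₗ[K] N.obj n p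
  map_act : ∀ {m n : ℕ} {p : ℤ} (σ : Fin m ≃ Fin n) (x : M.obj m p),
    app n p (M.act σ x) = N.act σ (app m p x)

/-- The desuspension `s⁻¹M`, with `(s⁻¹M)(n)_p = M(n)_{p+1}`. -/
def SigmaModule.desusp {K : Type u} [Field K] (M : SigmaModule K) : SigmaModule K where
  obj n p := M.obj n (p + 1)
  act σ := M.act σ
  act_refl := M.act_refl
  act_trans := M.act_trans

/-- The direct sum of a sequence of graded `Σ`-modules. -/
noncomputable def SigmaModule.directSum {K : Type u} [Field K] (E : ℕ → SigmaModule K) :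
    SigmaModule K where
  obj n p := DirectSum ℕ fun k => (E k).obj n p
  act σ := DirectSum.lmap fun k => (E k).act σ
  act_refl x := by
    induction x using DirectSum.induction_on with
    | zero => simp
    | of k y => exact (DirectSum.lmap_lof _ _ _).trans (by rw [SigmaModule.act_refl]; rfl)
    | add x y hx hy => rw [map_add, hx, hy]
  act_trans σ τ x := by
    induction x using DirectSum.induction_on with
    | zero => simp
    | of k y =>
      refine (DirectSum.lmap_lof _ _ _).trans ?_
      refine Eq.trans ?_ (congrArg _ (DirectSum.lmap_lof (R := K) _ _ _).symm)
      refine Eq.trans ?_ (DirectSum.lmap_lof (R := K) _ _ _).symm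
      rw [SigmaModule.act_trans]
    | add x y hx hy => simp only [map_add, hx, hy]

/-- The map out of a direct sum given by a map on each summand. -/
noncomputable def SigmaModule.Hom.desc {K : Type u} [Field K] {E : ℕ → SigmaModule K}
    {N : SigmaModule K} (ι : ∀ k, SigmaModule.Hom (E k) N) :
    SigmaModule.Hom (SigmaModule.directSum E) N where
  app n p := DirectSum.toModule K ℕ _ fun k => (ι k).app n p
  map_act {m n p} σ x := by
    have key : (DirectSum.toModule K ℕ _ fun k => (ι k).app n p) ∘ₗ
          (DirectSum.lmap fun k => (E k).act (p := p) σ) =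
        N.act σ ∘ₗ (DirectSum.toModule K ℕ _ fun k => (ι k).app m p) := by
      refine DirectSum.linearMap_ext K fun k => LinearMap.ext fun y => ?_
      simp only [LinearMap.comp_apply, DirectSum.lmap_lof, DirectSum.toModule_lof,
        (ι k).map_act]
    exact LinearMap.congr_fun key x

/-! ## Graded symmetric operads

Operads are unital and given by partial compositions. To avoid fixing an order on the inputs
of a composite, the composition `a ∘ᵢ b` comes with a bijection `e` numbering the inputs of the
composite, which are the inputs of `a` other than `i` together with the inputs of `b`. Likewise
the degree `r` of the composite comes with a proof of `p + q = r`. -/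

/-- A symmetric operad in graded `K`-vector spaces. -/
structure GradedOperad (K : Type u) [Field K] extends SigmaModule K where
  /-- the operadic identity -/
  one : obj 1 0
  /-- the partial composition `a ∘ᵢ b`, with inputs numbered by `e` -/
  comp : ∀ {m n k : ℕ} {p q r : ℤ} (i : Fin m) (_ : {x : Fin m // x ≠ i} ⊕ Fin n ≃ Fin k)
    (_ : p + q = r), obj m p →ₗ[K] obj n q →ₗ[K] obj k r
  /-- renumbering the inputs of a composite -/
  act_comp : ∀ {m n k l : ℕ} {p q r : ℤ} (i : Fin m)
    (e : {x : Fin m // x ≠ i} ⊕ Fin n ≃ Fin k) (h : p + q = r) (τ : Fin k ≃ Fin l)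
    (a : obj m p) (b : obj n q), act τ (comp i e h a b) = comp i (e.trans τ) h a b
  /-- renumbering the inputs of the two factors -/
  comp_act : ∀ {m m' n n' k : ℕ} {p q r : ℤ} (σ : Fin m ≃ Fin m') (τ : Fin n ≃ Fin n')
    (i : Fin m) (e : {x : Fin m // x ≠ i} ⊕ Fin n ≃ Fin k)
    (e' : {x : Fin m' // x ≠ σ i} ⊕ Fin n' ≃ Fin k) (h : p + q = r),
    (∀ x hx hx', e' (Sum.inl ⟨σ x, hx'⟩) = e (Sum.inl ⟨x, hx⟩)) →
    (∀ y, e' (Sum.inr (τ y)) = e (Sum.inr y)) →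
    ∀ (a : obj m p) (b : obj n q), comp (σ i) e' h (act σ a) (act τ b) = comp i e h a b
  /-- left unit law -/
  one_comp : ∀ {n k : ℕ} {q : ℤ} (i : Fin 1) (e : {x : Fin 1 // x ≠ i} ⊕ Fin n ≃ Fin k)
    (σ : Fin n ≃ Fin k), (∀ y, e (Sum.inr y) = σ y) →
    ∀ b : obj n q, comp i e (zero_add q) one b = act σ b
  /-- right unit law -/
  comp_one : ∀ {m k : ℕ} {p : ℤ} (i : Fin m) (e : {x : Fin m // x ≠ i} ⊕ Fin 1 ≃ Fin k)
    (σ : Fin m ≃ Fin k), (∀ x hx, e (Sum.inl ⟨x, hx⟩) = σ x) → e (Sum.inr 0) = σ i →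
    ∀ a : obj m p, comp i e (add_zero p) a one = act σ a
  /-- sequential associativity `(a ∘ᵢ b) ∘ⱼ c = a ∘ᵢ (b ∘ⱼ c)`, `j` an input of `b` -/
  comp_assoc : ∀ {l m n s t v : ℕ} {p q r pq qr pqr : ℤ} (i : Fin l) (j : Fin m)
    (e₁ : {x : Fin l // x ≠ i} ⊕ Fin m ≃ Fin s)
    (e₂ : {x : Fin s // x ≠ e₁ (Sum.inr j)} ⊕ Fin n ≃ Fin t)
    (e₃ : {x : Fin m // x ≠ j} ⊕ Fin n ≃ Fin v)
    (e₄ : {x : Fin l // x ≠ i} ⊕ Fin v ≃ Fin t)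
    (h₁ : p + q = pq) (h₂ : pq + r = pqr) (h₃ : q + r = qr) (h₄ : p + qr = pqr),
    (∀ x hx, e₂ (Sum.inl ⟨e₁ (Sum.inl x), hx⟩) = e₄ (Sum.inl x)) →
    (∀ y hy hy', e₂ (Sum.inl ⟨e₁ (Sum.inr y), hy⟩) = e₄ (Sum.inr (e₃ (Sum.inl ⟨y, hy'⟩)))) →
    (∀ z, e₂ (Sum.inr z) = e₄ (Sum.inr (e₃ (Sum.inr z)))) →
    ∀ (a : obj l p) (b : obj m q) (c : obj n r),
      comp (e₁ (Sum.inr j)) e₂ h₂ (comp i e₁ h₁ a b) c =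
        comp i e₄ h₄ a (comp j e₃ h₃ b c)
  /-- parallel associativity `(a ∘ᵢ b) ∘ⱼ c = (-1)^{|b||c|} (a ∘ⱼ c) ∘ᵢ b`, for inputs `i ≠ j`
  of `a` -/
  comp_comm : ∀ {l m n s t v : ℕ} {p q r pq pr pqr : ℤ} (i j : Fin l) (hji : j ≠ i) (hij : i ≠ j)
    (e₁ : {x : Fin l // x ≠ i} ⊕ Fin m ≃ Fin s)
    (e₂ : {x : Fin s // x ≠ e₁ (Sum.inl ⟨j, hji⟩)} ⊕ Fin n ≃ Fin t)
    (e₃ : {x : Fin l // x ≠ j} ⊕ Fin n ≃ Fin v)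
    (e₄ : {x : Fin v // x ≠ e₃ (Sum.inl ⟨i, hij⟩)} ⊕ Fin m ≃ Fin t)
    (h₁ : p + q = pq) (h₂ : pq + r = pqr) (h₃ : p + r = pr) (h₄ : pr + q = pqr),
    (∀ x hi hj hi' hj', e₂ (Sum.inl ⟨e₁ (Sum.inl ⟨x, hi⟩), hi'⟩) =
      e₄ (Sum.inl ⟨e₃ (Sum.inl ⟨x, hj⟩), hj'⟩)) →
    (∀ y hy, e₂ (Sum.inl ⟨e₁ (Sum.inr y), hy⟩) = e₄ (Sum.inr y)) →
    (∀ z hz, e₂ (Sum.inr z) = e₄ (Sum.inl ⟨e₃ (Sum.inr z), hz⟩)) →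
    ∀ (a : obj l p) (b : obj m q) (c : obj n r),
      comp (e₁ (Sum.inl ⟨j, hji⟩)) e₂ h₂ (comp i e₁ h₁ a b) c =
        (q * r).negOnePow • comp (e₃ (Sum.inl ⟨i, hij⟩)) e₄ h₄ (comp j e₃ h₃ a c) b

/-- Morphisms of graded operads. -/
@[ext]
structure GradedOperad.Hom {K : Type u} [Field K] (O P : GradedOperad K)
    extends toSigmaHom : SigmaModule.Hom O.toSigmaModule P.toSigmaModule where
  map_one : app 1 0 O.one = P.one
  map_comp : ∀ {m n k : ℕ} {p q r : ℤ} (i : Fin m) (e : {x : Fin m // x ≠ i} ⊕ Fin n ≃ Fin k)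
    (h : p + q = r) (a : O.obj m p) (b : O.obj n q),
    app k r (O.comp i e h a b) = P.comp i e h (app m p a) (app n q b)

/-! ## Chain operads -/

/-- A symmetric operad in chain complexes over `K`: a graded operad with a square-zero
differential of degree `-1` for which the structure maps are chain maps. -/
structure ChainOperad (K : Type u) [Field K] extends GradedOperad K where
  /-- the differential, from degree `p` to degree `q = p - 1` -/
  d : ∀ {n : ℕ} {p q : ℤ} (_ : q + 1 = p), obj n p →ₗ[K] obj n q
  d_d : ∀ {n : ℕ} {p q r : ℤ} (h : q + 1 = p) (h' : r + 1 = q) (x : obj n p), d h' (d h x) = 0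
  d_act : ∀ {m n : ℕ} {p q : ℤ} (h : q + 1 = p) (σ : Fin m ≃ Fin n) (x : obj m p),
    d h (act σ x) = act σ (d h x)
  /-- the Leibniz rule `∂(a ∘ᵢ b) = ∂a ∘ᵢ b + (-1)^{|a|} a ∘ᵢ ∂b` -/
  d_comp : ∀ {m n k : ℕ} {p q r p' q' r' : ℤ} (i : Fin m)
    (e : {x : Fin m // x ≠ i} ⊕ Fin n ≃ Fin k) (h : p + q = r) (hp : p' + 1 = p)
    (hq : q' + 1 = q) (hr : r' + 1 = r) (h₁ : p' + q = r') (h₂ : p + q' = r')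
    (a : obj m p) (b : obj n q),
    d hr (comp i e h a b) = comp i e h₁ (d hp a) b + p.negOnePow • comp i e h₂ a (d hq b)

/-- Morphisms of chain operads. -/
@[ext]
structure ChainOperad.Hom {K : Type u} [Field K] (O P : ChainOperad K)
    extends toGradedHom : GradedOperad.Hom O.toGradedOperad P.toGradedOperad where
  map_d : ∀ {n : ℕ} {p q : ℤ} (h : q + 1 = p) (x : O.obj n p),
    app n q (O.d h x) = P.d h (app n p x)

/-- The category of chain operads. -/
instance ChainOperad.category {K : Type u} [Field K] : Category (ChainOperad K) where
  Hom := ChainOperad.Hom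
  id O :=
    { app := fun _ _ => LinearMap.id
      map_act := fun _ _ => rfl
      map_one := rfl
      map_comp := fun _ _ _ _ _ => rfl
      map_d := fun _ _ => rfl }
  comp f g :=
    { app := fun n p => (g.app n p).comp (f.app n p)
      map_act := fun σ x => by simp [f.map_act, g.map_act]
      map_one := by simp [f.map_one, g.map_one]
      map_comp := fun i e h a b => by simp [f.map_comp, g.map_comp]
      map_d := fun h x => by simp [f.map_d, g.map_d] }

/-- A graded operad, regarded as a chain operad with trivial differential. -/
def GradedOperad.toChain {K : Type u} [Field K] (O : GradedOperad K) : ChainOperad K where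
  toGradedOperad := O
  d _ := 0
  d_d _ _ _ := rfl
  d_act _ _ _ := by simp
  d_comp _ _ _ _ _ _ _ _ _ _ := by simp

/-! ## Free operads

The free operad `⟨M⟩` consists of the formal operadic expressions in elements of `M`, where two
expressions are identified if they have the same value under every map from `M` to a graded
operad. -/

/-- Formal operadic expressions in the elements of `M`. -/
inductive SigmaModule.Term {K : Type u} [Field K] (M : SigmaModule K) : ℕ → ℤ → Type u
  | of {n : ℕ} {p : ℤ} (x : M.obj n p) : Term M n p
  | zero {n : ℕ} {p : ℤ} : Term M n p
  | add {n : ℕ} {p : ℤ} (s t : Term M n p) : Term M n p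
  | smul {n : ℕ} {p : ℤ} (c : K) (t : Term M n p) : Term M n p
  | act {m n : ℕ} {p : ℤ} (σ : Fin m ≃ Fin n) (t : Term M m p) : Term M n p
  | one : Term M 1 0
  | comp {m n k : ℕ} {p q r : ℤ} (i : Fin m) (e : {x : Fin m // x ≠ i} ⊕ Fin n ≃ Fin k)
      (h : p + q = r) (s : Term M m p) (t : Term M n q) : Term M k r

/-- The value of an expression under a map from `M` to a graded operad. -/
def SigmaModule.Term.eval {K : Type u} [Field K] {M : SigmaModule K} (O : GradedOperad K)
    (f : SigmaModule.Hom M O.toSigmaModule) : ∀ {n : ℕ} {p : ℤ}, M.Term n p → O.obj n p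
  | n, p, .of x => f.app n p x
  | _, _, .zero => 0
  | _, _, .add s t => s.eval O f + t.eval O f
  | _, _, .smul c t => c • t.eval O f
  | _, _, .act σ t => O.act σ (t.eval O f)
  | _, _, .one => O.one
  | _, _, .comp i e h s t => O.comp i e h (s.eval O f) (t.eval O f)

/-- Expressions are identified if they agree in every graded operad. -/
def SigmaModule.termSetoid {K : Type u} [Field K] (M : SigmaModule K) (n : ℕ) (p : ℤ) :
    Setoid (M.Term n p) where
  r s t := ∀ (O : GradedOperad K) (f : SigmaModule.Hom M O.toSigmaModule),
    s.eval O f = t.eval O f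
  iseqv := ⟨fun _ _ _ => rfl, fun h O f => (h O f).symm, fun h h' O f => (h O f).trans (h' O f)⟩

/-- The component of arity `n` and degree `p` of the free operad on `M`. -/
def SigmaModule.FreeObj {K : Type u} [Field K] (M : SigmaModule K) (n : ℕ) (p : ℤ) : Type u :=
  Quotient (M.termSetoid n p)

/-- The value of an element of the free operad under a map from `M` to a graded operad. -/
def SigmaModule.FreeObj.eval {K : Type u} [Field K] {M : SigmaModule K} (O : GradedOperad K)
    (f : SigmaModule.Hom M O.toSigmaModule) {n : ℕ} {p : ℤ} (x : M.FreeObj n p) : O.obj n p :=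
  Quotient.lift (s := M.termSetoid n p) (fun t => t.eval O f) (fun _ _ h => h O f) x

theorem SigmaModule.FreeObj.ext {K : Type u} [Field K] {M : SigmaModule K} {n : ℕ} {p : ℤ}
    {x y : M.FreeObj n p} (h : ∀ (O : GradedOperad K) (f : SigmaModule.Hom M O.toSigmaModule),
      x.eval O f = y.eval O f) : x = y := by
  induction x using Quotient.inductionOn
  induction y using Quotient.inductionOn
  exact Quotient.sound h

/-- The class of an expression. -/
def SigmaModule.FreeObj.mk {K : Type u} [Field K] {M : SigmaModule K} {n : ℕ} {p : ℤ}
    (t : M.Term n p) : M.FreeObj n p :=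
  Quotient.mk (M.termSetoid n p) t

instance SigmaModule.FreeObj.instZero {K : Type u} [Field K] {M : SigmaModule K} {n : ℕ}
    {p : ℤ} : Zero (M.FreeObj n p) := ⟨mk .zero⟩

instance SigmaModule.FreeObj.instAdd {K : Type u} [Field K] {M : SigmaModule K} {n : ℕ}
    {p : ℤ} : Add (M.FreeObj n p) :=
  ⟨Quotient.map₂ .add fun _ _ h _ _ h' O f => congrArg₂ (· + ·) (h O f) (h' O f)⟩

instance SigmaModule.FreeObj.instSMul {K : Type u} [Field K] {M : SigmaModule K} {n : ℕ}
    {p : ℤ} : SMul K (M.FreeObj n p) :=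
  ⟨fun c => Quotient.map (.smul c) fun _ _ h O f => congrArg (c • ·) (h O f)⟩

instance SigmaModule.FreeObj.instNeg {K : Type u} [Field K] {M : SigmaModule K} {n : ℕ}
    {p : ℤ} : Neg (M.FreeObj n p) := ⟨fun x => (-1 : K) • x⟩

theorem SigmaModule.FreeObj.eval_zero {K : Type u} [Field K] {M : SigmaModule K}
    (O : GradedOperad K) (f : SigmaModule.Hom M O.toSigmaModule) {n : ℕ} {p : ℤ} :
    (0 : M.FreeObj n p).eval O f = 0 := rfl

theorem SigmaModule.FreeObj.eval_add {K : Type u} [Field K] {M : SigmaModule K}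
    (O : GradedOperad K) (f : SigmaModule.Hom M O.toSigmaModule) {n : ℕ} {p : ℤ}
    (x y : M.FreeObj n p) : (x + y).eval O f = x.eval O f + y.eval O f := by
  induction x using Quotient.inductionOn
  induction y using Quotient.inductionOn
  rfl

theorem SigmaModule.FreeObj.eval_smul {K : Type u} [Field K] {M : SigmaModule K}
    (O : GradedOperad K) (f : SigmaModule.Hom M O.toSigmaModule) {n : ℕ} {p : ℤ}
    (c : K) (x : M.FreeObj n p) : (c • x).eval O f = c • x.eval O f := by
  induction x using Quotient.inductionOn
  rfl

theorem SigmaModule.FreeObj.eval_neg {K : Type u} [Field K] {M : SigmaModule K}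
    (O : GradedOperad K) (f : SigmaModule.Hom M O.toSigmaModule) {n : ℕ} {p : ℤ}
    (x : M.FreeObj n p) : (-x).eval O f = -x.eval O f :=
  (eval_smul O f (-1) x).trans (neg_one_smul K _)

instance SigmaModule.FreeObj.instAddCommGroup {K : Type u} [Field K] {M : SigmaModule K}
    {n : ℕ} {p : ℤ} : AddCommGroup (M.FreeObj n p) where
  add_assoc _ _ _ := ext fun _ _ => by simp only [eval_add, add_assoc]
  zero_add _ := ext fun _ _ => by simp only [eval_add, eval_zero, zero_add]
  add_zero _ := ext fun _ _ => by simp only [eval_add, eval_zero, add_zero]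
  add_comm _ _ := ext fun _ _ => by simp only [eval_add, add_comm]
  neg_add_cancel _ := ext fun _ _ => by simp only [eval_add, eval_neg, eval_zero, neg_add_cancel]
  nsmul := nsmulRec
  zsmul := zsmulRec

instance SigmaModule.FreeObj.instModule {K : Type u} [Field K] {M : SigmaModule K} {n : ℕ}
    {p : ℤ} : Module K (M.FreeObj n p) where
  one_smul _ := ext fun _ _ => by simp only [eval_smul, one_smul]
  mul_smul _ _ _ := ext fun _ _ => by simp only [eval_smul, mul_smul]
  smul_zero _ := ext fun _ _ => by simp only [eval_smul, eval_zero, smul_zero]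
  smul_add _ _ _ := ext fun _ _ => by simp only [eval_smul, eval_add, smul_add]
  add_smul _ _ _ := ext fun _ _ => by simp only [eval_smul, eval_add, add_smul]
  zero_smul _ := ext fun _ _ => by simp only [eval_smul, eval_zero, zero_smul]

/-- Evaluation as a linear map. -/
def SigmaModule.FreeObj.evalₗ {K : Type u} [Field K] {M : SigmaModule K}
    (O : GradedOperad K) (f : SigmaModule.Hom M O.toSigmaModule) (n : ℕ) (p : ℤ) :
    M.FreeObj n p →ₗ[K] O.obj n p where
  toFun x := x.eval O f
  map_add' := eval_add O f
  map_smul' := eval_smul O f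

/-- Renumbering the inputs of an element of the free operad. -/
def SigmaModule.FreeObj.actFun {K : Type u} [Field K] {M : SigmaModule K} {m n : ℕ} {p : ℤ}
    (σ : Fin m ≃ Fin n) : M.FreeObj m p → M.FreeObj n p :=
  Quotient.map (.act σ) fun _ _ h O f => congrArg (O.act σ) (h O f)

theorem SigmaModule.FreeObj.eval_actFun {K : Type u} [Field K] {M : SigmaModule K}
    (O : GradedOperad K) (f : SigmaModule.Hom M O.toSigmaModule) {m n : ℕ} {p : ℤ}
    (σ : Fin m ≃ Fin n) (x : M.FreeObj m p) :
    (actFun σ x).eval O f = O.act σ (x.eval O f) := by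
  induction x using Quotient.inductionOn
  rfl

/-- Composition of elements of the free operad. -/
def SigmaModule.FreeObj.compFun {K : Type u} [Field K] {M : SigmaModule K} {m n k : ℕ}
    {p q r : ℤ} (i : Fin m) (e : {x : Fin m // x ≠ i} ⊕ Fin n ≃ Fin k) (h : p + q = r) :
    M.FreeObj m p → M.FreeObj n q → M.FreeObj k r :=
  Quotient.map₂ (.comp i e h) fun _ _ h₁ _ _ h₂ O f =>
    congrArg₂ (fun a b => O.comp i e h a b) (h₁ O f) (h₂ O f)

theorem SigmaModule.FreeObj.eval_compFun {K : Type u} [Field K] {M : SigmaModule K}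
    (O : GradedOperad K) (f : SigmaModule.Hom M O.toSigmaModule) {m n k : ℕ}
    {p q r : ℤ} (i : Fin m) (e : {x : Fin m // x ≠ i} ⊕ Fin n ≃ Fin k) (h : p + q = r)
    (x : M.FreeObj m p) (y : M.FreeObj n q) :
    (compFun i e h x y).eval O f = O.comp i e h (x.eval O f) (y.eval O f) := by
  induction x using Quotient.inductionOn
  induction y using Quotient.inductionOn
  rfl

theorem SigmaModule.FreeObj.eval_negOnePow_smul {K : Type u} [Field K] {M : SigmaModule K}
    (O : GradedOperad K) (f : SigmaModule.Hom M O.toSigmaModule) {n : ℕ} {p : ℤ}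
    (a : ℤ) (x : M.FreeObj n p) : (a.negOnePow • x).eval O f = a.negOnePow • x.eval O f :=
  map_zsmul (evalₗ O f n p) (a.negOnePow : ℤ) x

/-- The free graded operad `⟨M⟩` on a graded `Σ`-module. -/
def SigmaModule.free {K : Type u} [Field K] (M : SigmaModule K) : GradedOperad K where
  obj := M.FreeObj
  act σ :=
    { toFun := FreeObj.actFun σ
      map_add' := fun _ _ => FreeObj.ext fun _ _ => by
        simp only [FreeObj.eval_add, FreeObj.eval_actFun, map_add]
      map_smul' := fun _ _ => FreeObj.ext fun _ _ => by
        simp only [FreeObj.eval_smul, FreeObj.eval_actFun, map_smul, RingHom.id_apply] }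
  act_refl _ := FreeObj.ext fun O _ => (FreeObj.eval_actFun _ _ _ _).trans (O.act_refl _)
  act_trans σ τ _ := FreeObj.ext fun O _ => by
    simp only [LinearMap.coe_mk, AddHom.coe_mk, FreeObj.eval_actFun, O.act_trans]
  one := FreeObj.mk .one
  comp i e h := LinearMap.mk₂ K (FreeObj.compFun i e h)
    (fun _ _ _ => FreeObj.ext fun _ _ => by
      simp only [FreeObj.eval_add, FreeObj.eval_compFun, map_add, LinearMap.add_apply])
    (fun _ _ _ => FreeObj.ext fun _ _ => by
      simp only [FreeObj.eval_smul, FreeObj.eval_compFun, map_smul, LinearMap.smul_apply])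
    (fun _ _ _ => FreeObj.ext fun _ _ => by
      simp only [FreeObj.eval_add, FreeObj.eval_compFun, map_add])
    (fun _ _ _ => FreeObj.ext fun _ _ => by
      simp only [FreeObj.eval_smul, FreeObj.eval_compFun, map_smul])
  act_comp i e h τ a b := FreeObj.ext fun O _ => by
    simp only [LinearMap.coe_mk, AddHom.coe_mk, LinearMap.mk₂_apply, FreeObj.eval_actFun,
      FreeObj.eval_compFun, O.act_comp]
  comp_act σ τ i e e' h H₁ H₂ a b := FreeObj.ext fun O _ => by
    simp only [LinearMap.coe_mk, AddHom.coe_mk, LinearMap.mk₂_apply, FreeObj.eval_actFun,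
      FreeObj.eval_compFun]
    exact O.comp_act σ τ i e e' h H₁ H₂ _ _
  one_comp i e σ H b := FreeObj.ext fun O _ => by
    simp only [LinearMap.coe_mk, AddHom.coe_mk, LinearMap.mk₂_apply, FreeObj.eval_actFun,
      FreeObj.eval_compFun]
    exact O.one_comp i e σ H _
  comp_one i e σ H H' a := FreeObj.ext fun O _ => by
    simp only [LinearMap.coe_mk, AddHom.coe_mk, LinearMap.mk₂_apply, FreeObj.eval_actFun,
      FreeObj.eval_compFun]
    exact O.comp_one i e σ H H' _
  comp_assoc i j e₁ e₂ e₃ e₄ h₁ h₂ h₃ h₄ H₁ H₂ H₃ a b c := FreeObj.ext fun O _ => by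
    simp only [LinearMap.mk₂_apply, FreeObj.eval_compFun]
    exact O.comp_assoc i j e₁ e₂ e₃ e₄ h₁ h₂ h₃ h₄ H₁ H₂ H₃ _ _ _
  comp_comm i j hji hij e₁ e₂ e₃ e₄ h₁ h₂ h₃ h₄ H₁ H₂ H₃ a b c := FreeObj.ext fun O _ => by
    simp only [LinearMap.mk₂_apply, FreeObj.eval_compFun, FreeObj.eval_negOnePow_smul]
    exact O.comp_comm i j hji hij e₁ e₂ e₃ e₄ h₁ h₂ h₃ h₄ H₁ H₂ H₃ _ _ _

/-- The inclusion of generators `M → U⟨M⟩`. -/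
def SigmaModule.freeOf {K : Type u} [Field K] (M : SigmaModule K) :
    SigmaModule.Hom M M.free.toSigmaModule where
  app _ _ :=
    { toFun := fun x => FreeObj.mk (.of x)
      map_add' := fun x y => FreeObj.ext fun _ f =>
        (map_add (f.app _ _) x y).trans
          (FreeObj.eval_add _ f (FreeObj.mk (.of x)) (FreeObj.mk (.of y))).symm
      map_smul' := fun c x => FreeObj.ext fun _ f =>
        (map_smul (f.app _ _) c x).trans (FreeObj.eval_smul _ f c (FreeObj.mk (.of x))).symm }
  map_act σ x := FreeObj.ext fun _ f =>
    (f.map_act σ x).trans (FreeObj.eval_actFun _ f σ (FreeObj.mk (.of x))).symm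

/-- The operad morphism `⟨M⟩ → O` extending a map `M → UO`. -/
def SigmaModule.freeLift {K : Type u} [Field K] {M : SigmaModule K} {O : GradedOperad K}
    (f : SigmaModule.Hom M O.toSigmaModule) : GradedOperad.Hom M.free O where
  app n p := FreeObj.evalₗ O f n p
  map_act σ x := FreeObj.eval_actFun O f σ x
  map_one := rfl
  map_comp i e h a b := FreeObj.eval_compFun O f i e h a b

theorem SigmaModule.freeLift_of {K : Type u} [Field K] {M : SigmaModule K} {O : GradedOperad K}
    (f : SigmaModule.Hom M O.toSigmaModule) {n : ℕ} {p : ℤ} (x : M.obj n p) :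
    (freeLift f).app n p (M.freeOf.app n p x) = f.app n p x := rfl

theorem SigmaModule.free_hom_ext {K : Type u} [Field K] {M : SigmaModule K} {O : GradedOperad K}
    {f g : GradedOperad.Hom M.free O}
    (h : ∀ (n : ℕ) (p : ℤ) (x : M.obj n p),
      f.app n p (M.freeOf.app n p x) = g.app n p (M.freeOf.app n p x)) : f = g := by
  have key : ∀ {n : ℕ} {p : ℤ} (t : M.Term n p),
      f.app n p (FreeObj.mk t) = g.app n p (FreeObj.mk t) := by
    intro n p t
    induction t with
    | of x => exact h _ _ x
    | zero => exact (map_zero (f.app _ _)).trans (map_zero (g.app _ _)).symm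
    | add s t hs ht =>
      exact (map_add (f.app _ _) (FreeObj.mk s) (FreeObj.mk t)).trans
        ((congrArg₂ (· + ·) hs ht).trans
          (map_add (g.app _ _) (FreeObj.mk s) (FreeObj.mk t)).symm)
    | smul c t ht =>
      exact (map_smul (f.app _ _) c (FreeObj.mk t)).trans
        ((congrArg (c • ·) ht).trans (map_smul (g.app _ _) c (FreeObj.mk t)).symm)
    | act σ t ht =>
      exact (f.map_act σ (FreeObj.mk t)).trans
        ((congrArg (O.act σ) ht).trans (g.map_act σ (FreeObj.mk t)).symm)
    | one => exact f.map_one.trans g.map_one.symm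
    | comp i e h s t hs ht =>
      exact (f.map_comp i e h (FreeObj.mk s) (FreeObj.mk t)).trans
        ((congrArg₂ (fun a b => O.comp i e h a b) hs ht).trans
          (g.map_comp i e h (FreeObj.mk s) (FreeObj.mk t)).symm)
  refine GradedOperad.Hom.ext ?_
  funext n p
  refine LinearMap.ext fun x => ?_
  induction x using Quotient.inductionOn with
  | h t => exact key t

/-! ## The chain operad `ch O` of a graded operad

`ch O` is generated by symbols `ι a` and `∂ a` for `a` in `O`, subject to the relations saying
that `ι` is a morphism of graded operads and that `∂` is the differential of a chain operad.
As above it is built from formal expressions in the elements of `O`, now including a formal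
differential, where expressions are identified if they have the same value under every morphism
of graded operads from `O` to a chain operad. -/

/-- Formal expressions in the elements of `O`, with a formal differential. -/
inductive GradedOperad.ChTerm {K : Type u} [Field K] (O : GradedOperad K) : ℕ → ℤ → Type u
  | of {n : ℕ} {p : ℤ} (x : O.obj n p) : ChTerm O n p
  | zero {n : ℕ} {p : ℤ} : ChTerm O n p
  | add {n : ℕ} {p : ℤ} (s t : ChTerm O n p) : ChTerm O n p
  | smul {n : ℕ} {p : ℤ} (c : K) (t : ChTerm O n p) : ChTerm O n p
  | act {m n : ℕ} {p : ℤ} (σ : Fin m ≃ Fin n) (t : ChTerm O m p) : ChTerm O n p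
  | comp {m n k : ℕ} {p q r : ℤ} (i : Fin m) (e : {x : Fin m // x ≠ i} ⊕ Fin n ≃ Fin k)
      (h : p + q = r) (s : ChTerm O m p) (t : ChTerm O n q) : ChTerm O k r
  | d {n : ℕ} {p q : ℤ} (h : q + 1 = p) (t : ChTerm O n p) : ChTerm O n q

/-- The value of an expression under a morphism from `O` to a chain operad. -/
def GradedOperad.ChTerm.eval {K : Type u} [Field K] {O : GradedOperad K} (Q : ChainOperad K)
    (f : GradedOperad.Hom O Q.toGradedOperad) : ∀ {n : ℕ} {p : ℤ}, O.ChTerm n p → Q.obj n p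
  | n, p, .of x => f.app n p x
  | _, _, .zero => 0
  | _, _, .add s t => s.eval Q f + t.eval Q f
  | _, _, .smul c t => c • t.eval Q f
  | _, _, .act σ t => Q.act σ (t.eval Q f)
  | _, _, .comp i e h s t => Q.comp i e h (s.eval Q f) (t.eval Q f)
  | _, _, .d h t => Q.d h (t.eval Q f)

/-- Expressions are identified if they agree in every chain operad. -/
def GradedOperad.chTermSetoid {K : Type u} [Field K] (O : GradedOperad K) (n : ℕ) (p : ℤ) :
    Setoid (O.ChTerm n p) where
  r s t := ∀ (Q : ChainOperad K) (f : GradedOperad.Hom O Q.toGradedOperad),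
    s.eval Q f = t.eval Q f
  iseqv := ⟨fun _ _ _ => rfl, fun h Q f => (h Q f).symm, fun h h' Q f => (h Q f).trans (h' Q f)⟩

/-- The component of arity `n` and degree `p` of `ch O`. -/
def GradedOperad.ChObj {K : Type u} [Field K] (O : GradedOperad K) (n : ℕ) (p : ℤ) : Type u :=
  Quotient (O.chTermSetoid n p)

/-- The value of an element of `ch O` under a morphism from `O` to a chain operad. -/
def GradedOperad.ChObj.eval {K : Type u} [Field K] {O : GradedOperad K} (Q : ChainOperad K)
    (f : GradedOperad.Hom O Q.toGradedOperad) {n : ℕ} {p : ℤ} (x : O.ChObj n p) : Q.obj n p :=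
  Quotient.lift (s := O.chTermSetoid n p) (fun t => t.eval Q f) (fun _ _ h => h Q f) x

theorem GradedOperad.ChObj.ext {K : Type u} [Field K] {O : GradedOperad K} {n : ℕ} {p : ℤ}
    {x y : O.ChObj n p} (h : ∀ (Q : ChainOperad K) (f : GradedOperad.Hom O Q.toGradedOperad),
      x.eval Q f = y.eval Q f) : x = y := by
  induction x using Quotient.inductionOn
  induction y using Quotient.inductionOn
  exact Quotient.sound h

/-- The class of an expression. -/
def GradedOperad.ChObj.mk {K : Type u} [Field K] {O : GradedOperad K} {n : ℕ} {p : ℤ}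
    (t : O.ChTerm n p) : O.ChObj n p :=
  Quotient.mk (O.chTermSetoid n p) t

instance GradedOperad.ChObj.instZero {K : Type u} [Field K] {O : GradedOperad K} {n : ℕ}
    {p : ℤ} : Zero (O.ChObj n p) := ⟨mk .zero⟩

instance GradedOperad.ChObj.instAdd {K : Type u} [Field K] {O : GradedOperad K} {n : ℕ}
    {p : ℤ} : Add (O.ChObj n p) :=
  ⟨Quotient.map₂ .add fun _ _ h _ _ h' Q f => congrArg₂ (· + ·) (h Q f) (h' Q f)⟩

instance GradedOperad.ChObj.instSMul {K : Type u} [Field K] {O : GradedOperad K} {n : ℕ}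
    {p : ℤ} : SMul K (O.ChObj n p) :=
  ⟨fun c => Quotient.map (.smul c) fun _ _ h Q f => congrArg (c • ·) (h Q f)⟩

instance GradedOperad.ChObj.instNeg {K : Type u} [Field K] {O : GradedOperad K} {n : ℕ}
    {p : ℤ} : Neg (O.ChObj n p) := ⟨fun x => (-1 : K) • x⟩

theorem GradedOperad.ChObj.eval_zero {K : Type u} [Field K] {O : GradedOperad K}
    (Q : ChainOperad K) (f : GradedOperad.Hom O Q.toGradedOperad) {n : ℕ} {p : ℤ} :
    (0 : O.ChObj n p).eval Q f = 0 := rfl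

theorem GradedOperad.ChObj.eval_add {K : Type u} [Field K] {O : GradedOperad K}
    (Q : ChainOperad K) (f : GradedOperad.Hom O Q.toGradedOperad) {n : ℕ} {p : ℤ}
    (x y : O.ChObj n p) : (x + y).eval Q f = x.eval Q f + y.eval Q f := by
  induction x using Quotient.inductionOn
  induction y using Quotient.inductionOn
  rfl

theorem GradedOperad.ChObj.eval_smul {K : Type u} [Field K] {O : GradedOperad K}
    (Q : ChainOperad K) (f : GradedOperad.Hom O Q.toGradedOperad) {n : ℕ} {p : ℤ}
    (c : K) (x : O.ChObj n p) : (c • x).eval Q f = c • x.eval Q f := by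
  induction x using Quotient.inductionOn
  rfl

theorem GradedOperad.ChObj.eval_neg {K : Type u} [Field K] {O : GradedOperad K}
    (Q : ChainOperad K) (f : GradedOperad.Hom O Q.toGradedOperad) {n : ℕ} {p : ℤ}
    (x : O.ChObj n p) : (-x).eval Q f = -x.eval Q f :=
  (eval_smul Q f (-1) x).trans (neg_one_smul K _)

instance GradedOperad.ChObj.instAddCommGroup {K : Type u} [Field K] {O : GradedOperad K}
    {n : ℕ} {p : ℤ} : AddCommGroup (O.ChObj n p) where
  add_assoc _ _ _ := ext fun _ _ => by simp only [eval_add, add_assoc]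
  zero_add _ := ext fun _ _ => by simp only [eval_add, eval_zero, zero_add]
  add_zero _ := ext fun _ _ => by simp only [eval_add, eval_zero, add_zero]
  add_comm _ _ := ext fun _ _ => by simp only [eval_add, add_comm]
  neg_add_cancel _ := ext fun _ _ => by simp only [eval_add, eval_neg, eval_zero, neg_add_cancel]
  nsmul := nsmulRec
  zsmul := zsmulRec

instance GradedOperad.ChObj.instModule {K : Type u} [Field K] {O : GradedOperad K} {n : ℕ}
    {p : ℤ} : Module K (O.ChObj n p) where
  one_smul _ := ext fun _ _ => by simp only [eval_smul, one_smul]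
  mul_smul _ _ _ := ext fun _ _ => by simp only [eval_smul, mul_smul]
  smul_zero _ := ext fun _ _ => by simp only [eval_smul, eval_zero, smul_zero]
  smul_add _ _ _ := ext fun _ _ => by simp only [eval_smul, eval_add, smul_add]
  add_smul _ _ _ := ext fun _ _ => by simp only [eval_smul, eval_add, add_smul]
  zero_smul _ := ext fun _ _ => by simp only [eval_smul, eval_zero, zero_smul]

/-- Evaluation as a linear map. -/
def GradedOperad.ChObj.evalₗ {K : Type u} [Field K] {O : GradedOperad K}
    (Q : ChainOperad K) (f : GradedOperad.Hom O Q.toGradedOperad) (n : ℕ) (p : ℤ) :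
    O.ChObj n p →ₗ[K] Q.obj n p where
  toFun x := x.eval Q f
  map_add' := eval_add Q f
  map_smul' := eval_smul Q f

/-- Renumbering the inputs of an element of `ch O`. -/
def GradedOperad.ChObj.actFun {K : Type u} [Field K] {O : GradedOperad K} {m n : ℕ} {p : ℤ}
    (σ : Fin m ≃ Fin n) : O.ChObj m p → O.ChObj n p :=
  Quotient.map (.act σ) fun _ _ h Q f => congrArg (Q.act σ) (h Q f)

theorem GradedOperad.ChObj.eval_actFun {K : Type u} [Field K] {O : GradedOperad K}
    (Q : ChainOperad K) (f : GradedOperad.Hom O Q.toGradedOperad) {m n : ℕ} {p : ℤ}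
    (σ : Fin m ≃ Fin n) (x : O.ChObj m p) :
    (actFun σ x).eval Q f = Q.act σ (x.eval Q f) := by
  induction x using Quotient.inductionOn
  rfl

/-- Composition of elements of `ch O`. -/
def GradedOperad.ChObj.compFun {K : Type u} [Field K] {O : GradedOperad K} {m n k : ℕ}
    {p q r : ℤ} (i : Fin m) (e : {x : Fin m // x ≠ i} ⊕ Fin n ≃ Fin k) (h : p + q = r) :
    O.ChObj m p → O.ChObj n q → O.ChObj k r :=
  Quotient.map₂ (.comp i e h) fun _ _ h₁ _ _ h₂ Q f =>
    congrArg₂ (fun a b => Q.comp i e h a b) (h₁ Q f) (h₂ Q f)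

theorem GradedOperad.ChObj.eval_compFun {K : Type u} [Field K] {O : GradedOperad K}
    (Q : ChainOperad K) (f : GradedOperad.Hom O Q.toGradedOperad) {m n k : ℕ}
    {p q r : ℤ} (i : Fin m) (e : {x : Fin m // x ≠ i} ⊕ Fin n ≃ Fin k) (h : p + q = r)
    (x : O.ChObj m p) (y : O.ChObj n q) :
    (compFun i e h x y).eval Q f = Q.comp i e h (x.eval Q f) (y.eval Q f) := by
  induction x using Quotient.inductionOn
  induction y using Quotient.inductionOn
  rfl

/-- The differential of `ch O`. -/
def GradedOperad.ChObj.dFun {K : Type u} [Field K] {O : GradedOperad K} {n : ℕ} {p q : ℤ}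
    (h : q + 1 = p) : O.ChObj n p → O.ChObj n q :=
  Quotient.map (.d h) fun _ _ h₁ Q f => congrArg (Q.d h) (h₁ Q f)

theorem GradedOperad.ChObj.eval_dFun {K : Type u} [Field K] {O : GradedOperad K}
    (Q : ChainOperad K) (f : GradedOperad.Hom O Q.toGradedOperad) {n : ℕ} {p q : ℤ}
    (h : q + 1 = p) (x : O.ChObj n p) : (dFun h x).eval Q f = Q.d h (x.eval Q f) := by
  induction x using Quotient.inductionOn
  rfl

theorem GradedOperad.ChObj.eval_negOnePow_smul {K : Type u} [Field K] {O : GradedOperad K}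
    (Q : ChainOperad K) (f : GradedOperad.Hom O Q.toGradedOperad) {n : ℕ} {p : ℤ}
    (a : ℤ) (x : O.ChObj n p) : (a.negOnePow • x).eval Q f = a.negOnePow • x.eval Q f :=
  map_zsmul (evalₗ Q f n p) (a.negOnePow : ℤ) x

/-- The chain operad `ch O` freely generated by a graded operad `O`. -/
def GradedOperad.ch {K : Type u} [Field K] (O : GradedOperad K) : ChainOperad K where
  obj := O.ChObj
  act σ :=
    { toFun := ChObj.actFun σ
      map_add' := fun _ _ => ChObj.ext fun _ _ => by
        simp only [ChObj.eval_add, ChObj.eval_actFun, map_add]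
      map_smul' := fun _ _ => ChObj.ext fun _ _ => by
        simp only [ChObj.eval_smul, ChObj.eval_actFun, map_smul, RingHom.id_apply] }
  act_refl _ := ChObj.ext fun Q _ => (ChObj.eval_actFun _ _ _ _).trans (Q.act_refl _)
  act_trans σ τ _ := ChObj.ext fun Q _ => by
    simp only [LinearMap.coe_mk, AddHom.coe_mk, ChObj.eval_actFun, Q.act_trans]
  one := ChObj.mk (.of O.one)
  comp i e h := LinearMap.mk₂ K (ChObj.compFun i e h)
    (fun _ _ _ => ChObj.ext fun _ _ => by
      simp only [ChObj.eval_add, ChObj.eval_compFun, map_add, LinearMap.add_apply])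
    (fun _ _ _ => ChObj.ext fun _ _ => by
      simp only [ChObj.eval_smul, ChObj.eval_compFun, map_smul, LinearMap.smul_apply])
    (fun _ _ _ => ChObj.ext fun _ _ => by
      simp only [ChObj.eval_add, ChObj.eval_compFun, map_add])
    (fun _ _ _ => ChObj.ext fun _ _ => by
      simp only [ChObj.eval_smul, ChObj.eval_compFun, map_smul])
  act_comp i e h τ a b := ChObj.ext fun Q _ => by
    simp only [LinearMap.coe_mk, AddHom.coe_mk, LinearMap.mk₂_apply, ChObj.eval_actFun,
      ChObj.eval_compFun, Q.act_comp]
  comp_act σ τ i e e' h H₁ H₂ a b := ChObj.ext fun Q _ => by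
    simp only [LinearMap.coe_mk, AddHom.coe_mk, LinearMap.mk₂_apply, ChObj.eval_actFun,
      ChObj.eval_compFun]
    exact Q.comp_act σ τ i e e' h H₁ H₂ _ _
  one_comp i e σ H b := ChObj.ext fun Q f => by
    simp only [LinearMap.coe_mk, AddHom.coe_mk, LinearMap.mk₂_apply, ChObj.eval_actFun,
      ChObj.eval_compFun]
    refine Eq.trans ?_ (Q.one_comp i e σ H _)
    exact congrArg (fun a => Q.comp i e (zero_add _) a _) f.map_one
  comp_one i e σ H H' a := ChObj.ext fun Q f => by
    simp only [LinearMap.coe_mk, AddHom.coe_mk, LinearMap.mk₂_apply, ChObj.eval_actFun,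
      ChObj.eval_compFun]
    refine Eq.trans ?_ (Q.comp_one i e σ H H' _)
    exact congrArg (fun b => Q.comp i e (add_zero _) _ b) f.map_one
  comp_assoc i j e₁ e₂ e₃ e₄ h₁ h₂ h₃ h₄ H₁ H₂ H₃ a b c := ChObj.ext fun Q _ => by
    simp only [LinearMap.mk₂_apply, ChObj.eval_compFun]
    exact Q.comp_assoc i j e₁ e₂ e₃ e₄ h₁ h₂ h₃ h₄ H₁ H₂ H₃ _ _ _
  comp_comm i j hji hij e₁ e₂ e₃ e₄ h₁ h₂ h₃ h₄ H₁ H₂ H₃ a b c := ChObj.ext fun Q _ => by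
    simp only [LinearMap.mk₂_apply, ChObj.eval_compFun, ChObj.eval_negOnePow_smul]
    exact Q.comp_comm i j hji hij e₁ e₂ e₃ e₄ h₁ h₂ h₃ h₄ H₁ H₂ H₃ _ _ _
  d h :=
    { toFun := ChObj.dFun h
      map_add' := fun _ _ => ChObj.ext fun _ _ => by
        simp only [ChObj.eval_add, ChObj.eval_dFun, map_add]
      map_smul' := fun _ _ => ChObj.ext fun _ _ => by
        simp only [ChObj.eval_smul, ChObj.eval_dFun, map_smul, RingHom.id_apply] }
  d_d h h' x := ChObj.ext fun Q _ => by
    simp only [LinearMap.coe_mk, AddHom.coe_mk, ChObj.eval_dFun, Q.d_d, ChObj.eval_zero]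
  d_act h σ x := ChObj.ext fun Q _ => by
    simp only [LinearMap.coe_mk, AddHom.coe_mk, ChObj.eval_dFun, ChObj.eval_actFun, Q.d_act]
  d_comp i e h hp hq hr h₁ h₂ a b := ChObj.ext fun Q _ => by
    simp only [LinearMap.coe_mk, AddHom.coe_mk, LinearMap.mk₂_apply, ChObj.eval_dFun,
      ChObj.eval_compFun, ChObj.eval_add, ChObj.eval_negOnePow_smul]
    exact Q.d_comp i e h hp hq hr h₁ h₂ _ _

/-- The canonical morphism of graded operads `ι : O → ch O`. -/
def GradedOperad.chOf {K : Type u} [Field K] (O : GradedOperad K) :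
    GradedOperad.Hom O O.ch.toGradedOperad where
  app _ _ :=
    { toFun := fun x => ChObj.mk (.of x)
      map_add' := fun x y => ChObj.ext fun _ f =>
        (map_add (f.app _ _) x y).trans
          (ChObj.eval_add _ f (ChObj.mk (.of x)) (ChObj.mk (.of y))).symm
      map_smul' := fun c x => ChObj.ext fun _ f =>
        (map_smul (f.app _ _) c x).trans (ChObj.eval_smul _ f c (ChObj.mk (.of x))).symm }
  map_act σ x := ChObj.ext fun _ f =>
    (f.map_act σ x).trans (ChObj.eval_actFun _ f σ (ChObj.mk (.of x))).symm
  map_one := rfl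
  map_comp i e h a b := ChObj.ext fun _ f =>
    (f.map_comp i e h a b).trans
      (ChObj.eval_compFun _ f i e h (ChObj.mk (.of a)) (ChObj.mk (.of b))).symm

/-- The morphism of chain operads `ch O → Q` extending a morphism of graded operads `O → Q`. -/
def GradedOperad.chLift {K : Type u} [Field K] {O : GradedOperad K} {Q : ChainOperad K}
    (f : GradedOperad.Hom O Q.toGradedOperad) : O.ch ⟶ Q where
  app n p := ChObj.evalₗ Q f n p
  map_act σ x := ChObj.eval_actFun Q f σ x
  map_one := f.map_one
  map_comp i e h a b := ChObj.eval_compFun Q f i e h a b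
  map_d h x := ChObj.eval_dFun Q f h x

theorem GradedOperad.chLift_of {K : Type u} [Field K] {O : GradedOperad K} {Q : ChainOperad K}
    (f : GradedOperad.Hom O Q.toGradedOperad) {n : ℕ} {p : ℤ} (x : O.obj n p) :
    (chLift f).app n p (O.chOf.app n p x) = f.app n p x := rfl

theorem GradedOperad.ch_hom_ext {K : Type u} [Field K] {O : GradedOperad K} {Q : ChainOperad K}
    {f g : O.ch ⟶ Q} (h : ∀ (n : ℕ) (p : ℤ) (x : O.obj n p),
      f.app n p (O.chOf.app n p x) = g.app n p (O.chOf.app n p x)) : f = g := by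
  have key : ∀ {n : ℕ} {p : ℤ} (t : O.ChTerm n p),
      f.app n p (ChObj.mk t) = g.app n p (ChObj.mk t) := by
    intro n p t
    induction t with
    | of x => exact h _ _ x
    | zero => exact (map_zero (f.app _ _)).trans (map_zero (g.app _ _)).symm
    | add s t hs ht =>
      exact (map_add (f.app _ _) (ChObj.mk s) (ChObj.mk t)).trans
        ((congrArg₂ (· + ·) hs ht).trans
          (map_add (g.app _ _) (ChObj.mk s) (ChObj.mk t)).symm)
    | smul c t ht =>
      exact (map_smul (f.app _ _) c (ChObj.mk t)).trans
        ((congrArg (c • ·) ht).trans (map_smul (g.app _ _) c (ChObj.mk t)).symm)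
    | act σ t ht =>
      exact (f.map_act σ (ChObj.mk t)).trans
        ((congrArg (Q.act σ) ht).trans (g.map_act σ (ChObj.mk t)).symm)
    | comp i e h s t hs ht =>
      exact (f.map_comp i e h (ChObj.mk s) (ChObj.mk t)).trans
        ((congrArg₂ (fun a b => Q.comp i e h a b) hs ht).trans
          (g.map_comp i e h (ChObj.mk s) (ChObj.mk t)).symm)
    | d h t ht =>
      exact (f.map_d h (ChObj.mk t)).trans
        ((congrArg (Q.d h) ht).trans (g.map_d h (ChObj.mk t)).symm)
  refine ChainOperad.Hom.ext ?_
  funext n p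
  refine LinearMap.ext fun x => ?_
  induction x using Quotient.inductionOn with
  | h t => exact key t

/-! ## Universal linking operads and link operads -/

/-- The morphism `ch⟨s⁻¹G⟩ → Q` induced by `φ : s⁻¹G → UQ`. -/
def ChainOperad.linkAttach {K : Type u} [Field K] {G : SigmaModule K} {Q : ChainOperad K}
    (φ : SigmaModule.Hom G.desusp Q.toSigmaModule) : G.desusp.free.ch ⟶ Q :=
  GradedOperad.chLift (SigmaModule.freeLift φ)

/-- The map `s⁻¹G → U ch P`, `s⁻¹x ↦ ∂(ι(g x))`, for a map `g : G → UP`. -/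
def GradedOperad.boundaryOf {K : Type u} [Field K] {G : SigmaModule K} {P : GradedOperad K}
    (g : SigmaModule.Hom G P.toSigmaModule) : SigmaModule.Hom G.desusp P.ch.toSigmaModule where
  app n p := (P.ch.d (n := n) (p := p + 1) (q := p) rfl).comp
    ((P.chOf.app n (p + 1)).comp (g.app n (p + 1)))
  map_act {m n p} σ x :=
    (congrArg (fun y => P.ch.d rfl (P.chOf.app n (p + 1) y)) (g.map_act (p := p + 1) σ x)).trans
      ((congrArg (P.ch.d rfl) (P.chOf.map_act σ (g.app m (p + 1) x))).trans
        (P.ch.d_act rfl σ (P.chOf.app m (p + 1) (g.app m (p + 1) x))))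

/-- The morphism `ch⟨s⁻¹G⟩ → ch P` sending a generator `s⁻¹x` to `∂(ι(g x))`. -/
def GradedOperad.linkBoundary {K : Type u} [Field K] {G : SigmaModule K} {P : GradedOperad K}
    (g : SigmaModule.Hom G P.toSigmaModule) : G.desusp.free.ch ⟶ P.ch :=
  GradedOperad.chLift (SigmaModule.freeLift (GradedOperad.boundaryOf g))

/-- `L`, with the morphisms `inQ` and `inP`, is the universal linking operad `lu_φ(P, Q)`, where
`P` is generated by `g : G → UP`: the pushout of `Q ← ch⟨s⁻¹G⟩ → ch P` in chain operads. -/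
def IsUniversalLinking {K : Type u} [Field K] {G : SigmaModule K} {P : GradedOperad K}
    (g : SigmaModule.Hom G P.toSigmaModule) {Q : ChainOperad K}
    (φ : SigmaModule.Hom G.desusp Q.toSigmaModule) {L : ChainOperad K}
    (inQ : Q ⟶ L) (inP : P.ch ⟶ L) : Prop :=
  IsPushout (ChainOperad.linkAttach φ) (GradedOperad.linkBoundary g) inQ inP

/-- The finite stages of the link operad of the free operads `⟨M 0⟩, ⟨M 1⟩, …`:
`stage 0 = ⟨M 0⟩` with trivial differential, and `stage (n + 1) = lu(⟨M (n + 1)⟩, stage n)` with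
respect to a specified map `φ n` from the desuspension of `M (n + 1)` to `stage n`. -/
structure LinkTower {K : Type u} [Field K] (M : ℕ → SigmaModule K) where
  /-- the finite link operads -/
  stage : ℕ → ChainOperad K
  /-- the identification of the initial stage -/
  base : stage 0 ≅ (M 0).free.toChain
  /-- the linking maps -/
  φ : ∀ n : ℕ, SigmaModule.Hom (M (n + 1)).desusp (stage n).toSigmaModule
  /-- the canonical morphism to the next stage -/
  incl : ∀ n : ℕ, stage n ⟶ stage (n + 1)
  /-- the canonical morphism from the operad that is linked on -/
  cell : ∀ n : ℕ, (M (n + 1)).free.ch ⟶ stage (n + 1)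
  isUniversalLinking : ∀ n : ℕ,
    IsUniversalLinking (M (n + 1)).freeOf (φ n) (incl n) (cell n)

/-! ## Minimal operads -/

/-- Membership in the suboperad generated by a family of subsets of a graded operad. -/
inductive GradedOperad.Generated {K : Type u} [Field K] (O : GradedOperad K)
    (S : ∀ (n : ℕ) (p : ℤ), Set (O.obj n p)) : ∀ {n : ℕ} {p : ℤ}, O.obj n p → Prop
  | gen {n : ℕ} {p : ℤ} (x : O.obj n p) (hx : x ∈ S n p) : Generated O S x
  | one : Generated O S O.one
  | zero (n : ℕ) (p : ℤ) : Generated O S (0 : O.obj n p)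
  | add {n : ℕ} {p : ℤ} (x y : O.obj n p) (hx : Generated O S x) (hy : Generated O S y) :
      Generated O S (x + y)
  | smul {n : ℕ} {p : ℤ} (c : K) (x : O.obj n p) (hx : Generated O S x) : Generated O S (c • x)
  | act {m n : ℕ} {p : ℤ} (σ : Fin m ≃ Fin n) (x : O.obj m p) (hx : Generated O S x) :
      Generated O S (O.act σ x)
  | comp {m n k : ℕ} {p q r : ℤ} (i : Fin m) (e : {x : Fin m // x ≠ i} ⊕ Fin n ≃ Fin k)
      (h : p + q = r) (a : O.obj m p) (b : O.obj n q) (ha : Generated O S a)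
      (hb : Generated O S b) : Generated O S (O.comp i e h a b)

/-- The weight filtration with respect to a family `S` of subsets of a graded operad: `x` has
weight at least `w` if it is a linear combination of iterated composites (composition trees),
each of which involves at least `w` factors (nodes) in `S`. -/
inductive GradedOperad.WeightGE {K : Type u} [Field K] (O : GradedOperad K)
    (S : ∀ (n : ℕ) (p : ℤ), Set (O.obj n p)) : ℕ → ∀ {n : ℕ} {p : ℤ}, O.obj n p → Prop
  | gen {n : ℕ} {p : ℤ} (x : O.obj n p) (hx : x ∈ S n p) : WeightGE O S 1 x
  | one : WeightGE O S 0 O.one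
  | zero (w n : ℕ) (p : ℤ) : WeightGE O S w (0 : O.obj n p)
  | add {w n : ℕ} {p : ℤ} (x y : O.obj n p) (hx : WeightGE O S w x) (hy : WeightGE O S w y) :
      WeightGE O S w (x + y)
  | smul {w n : ℕ} {p : ℤ} (c : K) (x : O.obj n p) (hx : WeightGE O S w x) :
      WeightGE O S w (c • x)
  | act {w m n : ℕ} {p : ℤ} (σ : Fin m ≃ Fin n) (x : O.obj m p) (hx : WeightGE O S w x) :
      WeightGE O S w (O.act σ x)
  | comp {v w m n k : ℕ} {p q r : ℤ} (i : Fin m) (e : {x : Fin m // x ≠ i} ⊕ Fin n ≃ Fin k)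
      (h : p + q = r) (a : O.obj m p) (b : O.obj n q) (ha : WeightGE O S v a)
      (hb : WeightGE O S w b) : WeightGE O S (v + w) (O.comp i e h a b)
  | mono {v w n : ℕ} {p : ℤ} (hvw : v ≤ w) (x : O.obj n p) (hx : WeightGE O S w x) :
      WeightGE O S v x

/-- A chain operad `L` is minimal if it is quasi-free on a graded `Σ`-module `E = ⨁ₖ Eₖ` (that is,
the underlying graded operad of `L` is free on `E`), with a differential that is decomposable
(`∂E` lies in the part of `⟨E⟩` of weight at least two) and such that `∂Eₖ` lies in the suboperad
generated by `⨁_{i < k} Eᵢ`, for every `k`. -/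
def ChainOperad.IsMinimal {K : Type u} [Field K] (L : ChainOperad K) : Prop :=
  ∃ (E : ℕ → SigmaModule K) (ι : ∀ k, SigmaModule.Hom (E k) L.toSigmaModule),
    (∀ (n : ℕ) (p : ℤ), Function.Bijective
      ((SigmaModule.freeLift (O := L.toGradedOperad) (SigmaModule.Hom.desc ι)).app n p)) ∧
    (∀ (k n : ℕ) (p : ℤ) (x : (E k).obj n (p + 1)),
      L.toGradedOperad.WeightGE
        (fun n p => Set.range ((SigmaModule.Hom.desc ι).app n p)) 2
        (L.d (q := p) rfl ((ι k).app n (p + 1) x))) ∧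
    (∀ (k n : ℕ) (p : ℤ) (x : (E k).obj n (p + 1)),
      L.toGradedOperad.Generated
        (fun n p => {y | ∃ i < k, y ∈ Set.range ((ι i).app n p)})
        (L.d (q := p) rfl ((ι k).app n (p + 1) x)))

/-- The arities in which a graded `Σ`-module is nonzero. -/
def SigmaModule.arities {K : Type u} [Field K] (M : SigmaModule K) : Set ℕ :=
  {n | ∃ p : ℤ, Nontrivial (M.obj n p)}

/-! The modules `M k` themselves serve as the generators `E k`, and two things need proof: that `L`
is free on their sum as a graded operad, and that `∂` is decomposable.

Freeness. Forgetting the differential has a right adjoint `P ↦ P[ε]/(ε²)`, so morphisms of graded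
operads out of a pushout or colimit `L` of chain operads can be studied as chain morphisms `L ⟶
P[ε]`. When `φ` takes values in cycles, a graded morphism `f : Q → P` and a map `g : G → P` extend
to the linking operad: on generators one prescribes `x ↦ g x + ε f (φ x)`, whose differential `f (φ
x)` is the value of the lift of `f` at `φ x`, because `f (∂φ x) = 0` (`exists_graded_hom`). The
extension is unique (`graded_hom_ext`). Hence, as a graded operad, each stage adjoins `M (j + 1)`
freely, and the colimit has the universal property of the free operad on the direct sum
(`bijective_freeLift`).

Differential. It vanishes on `M 0`, and `∂x = φ x` for `x` in `M (j + 1)`. So `∂x` lies in stage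
`j`, which is generated by `M 0, …, M j` (`generated_toColimit`); this is the condition on the
filtration.

Decomposability is a count of arities. If `x ≠ 0` has arity `n`, then all `M i` with `i ≤ j` vanish
in arities at least `n`. A tree with a single node has the arity of that node, and the tree without
nodes is the identity, of arity one. So if `n ≠ 1`, only trees with at least two nodes contribute to
`φ x` (`Generated.weightGE`). If `n = 1`, the earlier generators all have arity zero, and every
element of positive arity that they generate is a multiple of the identity (`Generated.isScalar`). A
nonzero multiple could be rescaled to the identity, which is not a value of `φ`; so `∂x = 0`
(`φ_arity_one`). -/

/-! ## The cofree chain operad on a graded operad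

The forgetful functor from chain operads to graded operads has a right adjoint. It sends `P` to
`P[ε]/(ε²)`, where `ε` has degree one, with the differential `∂/∂ε`. Hence the forgetful functor
preserves colimits. -/

namespace GradedOperad

variable {K : Type u} [Field K]

/-- The elements `a + ε a'` of arity `n` and degree `p`, where `a'` has degree `p - 1`. -/
abbrev CofreeObj (P : GradedOperad K) (n : ℕ) (p : ℤ) : Type u :=
  P.obj n p × (∀ q : {q : ℤ // q + 1 = p}, P.obj n q.1)

/-- The coefficient of `ε` is a family over all `q` with `q + 1 = p`. There is exactly one such `q`,
and quantifying over it avoids transport along equalities of degrees. -/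
theorem CofreeObj.ext {P : GradedOperad K} {n : ℕ} {p : ℤ} {x y : P.CofreeObj n p}
    (h₁ : x.1 = y.1) (h₂ : ∀ q h, x.2 ⟨q, h⟩ = y.2 ⟨q, h⟩) : x = y :=
  Prod.ext h₁ (funext fun q => h₂ q.1 q.2)

/-- The coefficient of `ε` in `(a + ε a') ∘ᵢ (b + ε b')`. -/
def cofreeCompSnd (P : GradedOperad K) {m n k : ℕ} {p q r : ℤ} (i : Fin m)
    (e : {x : Fin m // x ≠ i} ⊕ Fin n ≃ Fin k) (h : p + q = r) (x : P.CofreeObj m p)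
    (y : P.CofreeObj n q) (s : ℤ) (hs : s + 1 = r) : P.obj k s :=
  P.comp i e (p := p - 1) (q := q) (by omega) (x.2 ⟨p - 1, by omega⟩) y.1 +
    p.negOnePow • P.comp i e (p := p) (q := q - 1) (by omega) x.1 (y.2 ⟨q - 1, by omega⟩)

/-- The definition commits to the degrees `p - 1` and `q - 1`; with free `p'` and `q'` the formula
also applies to degrees that arise in another form. -/
theorem cofreeCompSnd_eq (P : GradedOperad K) {m n k : ℕ} {p q r p' q' : ℤ} (i : Fin m)
    (e : {x : Fin m // x ≠ i} ⊕ Fin n ≃ Fin k) (h : p + q = r) (x : P.CofreeObj m p)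
    (y : P.CofreeObj n q) (s : ℤ) (hs : s + 1 = r) (hp : p' + 1 = p) (hq : q' + 1 = q)
    (h₁ : p' + q = s) (h₂ : p + q' = s) :
    P.cofreeCompSnd i e h x y s hs =
      P.comp i e h₁ (x.2 ⟨p', hp⟩) y.1 + p.negOnePow • P.comp i e h₂ x.1 (y.2 ⟨q', hq⟩) := by
  obtain rfl : p' = p - 1 := by omega
  obtain rfl : q' = q - 1 := by omega
  rfl

/-- Composition in `P[ε]`. -/
def cofreeComp (P : GradedOperad K) {m n k : ℕ} {p q r : ℤ} (i : Fin m)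
    (e : {x : Fin m // x ≠ i} ⊕ Fin n ≃ Fin k) (h : p + q = r) :
    P.CofreeObj m p →ₗ[K] P.CofreeObj n q →ₗ[K] P.CofreeObj k r :=
  LinearMap.mk₂ K
    (fun x y => (P.comp i e h x.1 y.1, fun s => P.cofreeCompSnd i e h x y s.1 s.2))
    (fun x x' y => CofreeObj.ext (by simp) fun s hs => by
      simp [cofreeCompSnd]; abel)
    (fun c x y => CofreeObj.ext (by simp) fun s hs => by
      simp [cofreeCompSnd, smul_comm c])
    (fun x y y' => CofreeObj.ext (by simp) fun s hs => by
      simp [cofreeCompSnd]; abel)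
    (fun c x y => CofreeObj.ext (by simp) fun s hs => by
      simp [cofreeCompSnd, smul_comm c])

theorem cofreeComp_fst (P : GradedOperad K) {m n k : ℕ} {p q r : ℤ} (i : Fin m)
    (e : {x : Fin m // x ≠ i} ⊕ Fin n ≃ Fin k) (h : p + q = r) (x : P.CofreeObj m p)
    (y : P.CofreeObj n q) : (P.cofreeComp i e h x y).1 = P.comp i e h x.1 y.1 := rfl

theorem cofreeComp_snd (P : GradedOperad K) {m n k : ℕ} {p q r p' q' : ℤ} (i : Fin m)
    (e : {x : Fin m // x ≠ i} ⊕ Fin n ≃ Fin k) (h : p + q = r) (x : P.CofreeObj m p)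
    (y : P.CofreeObj n q) (s : ℤ) (hs : s + 1 = r) (hp : p' + 1 = p) (hq : q' + 1 = q)
    (h₁ : p' + q = s) (h₂ : p + q' = s) :
    (P.cofreeComp i e h x y).2 ⟨s, hs⟩ =
      P.comp i e h₁ (x.2 ⟨p', hp⟩) y.1 + p.negOnePow • P.comp i e h₂ x.1 (y.2 ⟨q', hq⟩) :=
  P.cofreeCompSnd_eq i e h x y s hs hp hq h₁ h₂

/-- The action of the symmetric groups on `P[ε]`. -/
def cofreeAct (P : GradedOperad K) {m n : ℕ} {p : ℤ} (σ : Fin m ≃ Fin n) :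
    P.CofreeObj m p →ₗ[K] P.CofreeObj n p where
  toFun x := (P.act σ x.1, fun s => P.act σ (x.2 s))
  map_add' x y := CofreeObj.ext (by simp) fun s hs => by simp
  map_smul' c x := CofreeObj.ext (by simp) fun s hs => by simp

/-- Signs are units of `ℤ` and act through it, so additivity of the structure maps is enough, here
and in the next two lemmas. -/
theorem act_negOnePow_smul (P : GradedOperad K) {m n : ℕ} {p : ℤ} (σ : Fin m ≃ Fin n) (a : ℤ)
    (x : P.obj m p) : P.act σ (a.negOnePow • x) = a.negOnePow • P.act σ x :=
  map_zsmul (P.act σ) (a.negOnePow : ℤ) x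

theorem comp_negOnePow_smul (P : GradedOperad K) {m n k : ℕ} {p q r : ℤ} (i : Fin m)
    (e : {x : Fin m // x ≠ i} ⊕ Fin n ≃ Fin k) (h : p + q = r) (a : ℤ)
    (x : P.obj m p) (y : P.obj n q) :
    P.comp i e h x (a.negOnePow • y) = a.negOnePow • P.comp i e h x y :=
  map_zsmul (P.comp i e h x) (a.negOnePow : ℤ) y

theorem negOnePow_smul_comp (P : GradedOperad K) {m n k : ℕ} {p q r : ℤ} (i : Fin m)
    (e : {x : Fin m // x ≠ i} ⊕ Fin n ≃ Fin k) (h : p + q = r) (a : ℤ)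
    (x : P.obj m p) (y : P.obj n q) :
    P.comp i e h (a.negOnePow • x) y = a.negOnePow • P.comp i e h x y :=
  map_zsmul ((P.comp i e h).flip y) (a.negOnePow : ℤ) x

theorem zero_comp (P : GradedOperad K) {m n k : ℕ} {p q r : ℤ} (i : Fin m)
    (e : {x : Fin m // x ≠ i} ⊕ Fin n ≃ Fin k) (h : p + q = r) (y : P.obj n q) :
    P.comp i e h 0 y = 0 := by
  rw [map_zero, LinearMap.zero_apply]

/-- The cofree chain operad `P[ε]/(ε²)` on a graded operad `P`. -/
def cofree (P : GradedOperad K) : ChainOperad K where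
  obj := P.CofreeObj
  act σ := P.cofreeAct σ
  act_refl x := CofreeObj.ext (P.act_refl _) fun _ _ => P.act_refl _
  act_trans σ τ x := CofreeObj.ext (P.act_trans _ _ _) fun _ _ => P.act_trans _ _ _
  one := (P.one, 0)
  comp i e h := P.cofreeComp i e h
  act_comp i e h τ a b := CofreeObj.ext (P.act_comp _ _ _ _ _ _) fun s hs => by
    refine (map_add (P.act τ) _ _).trans ?_
    rw [act_negOnePow_smul, P.act_comp, P.act_comp]
    rfl
  comp_act σ τ i e e' h H₁ H₂ a b :=
    CofreeObj.ext (P.comp_act σ τ i e e' h H₁ H₂ _ _) fun s hs =>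
      congrArg₂ (· + ·) (P.comp_act σ τ i e e' _ H₁ H₂ _ _)
        (congrArg (_ • ·) (P.comp_act σ τ i e e' _ H₁ H₂ _ _))
  one_comp i e σ H b := CofreeObj.ext (P.one_comp i e σ H _) fun s hs => by
    rw [P.cofreeComp_snd (p' := -1) (q' := s) i e _ _ _ s hs rfl hs (by omega) (by omega)]
    refine Eq.trans (congrArg₂ (· + ·) (P.zero_comp _ _ _ _) ?_) (zero_add _)
    exact (one_smul ℤˣ _).trans (P.one_comp i e σ H _)
  comp_one i e σ H H' a := CofreeObj.ext (P.comp_one i e σ H H' _) fun s hs => by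
    rw [P.cofreeComp_snd (p' := s) (q' := -1) i e _ _ _ s hs hs rfl (by omega) (by omega)]
    refine Eq.trans (congrArg₂ (· + ·) (P.comp_one i e σ H H' _) ?_) (add_zero _)
    exact (congrArg (_ • ·) (map_zero _)).trans (smul_zero _)
  comp_assoc {l m n s t v p q r pq qr pqr} i j e₁ e₂ e₃ e₄ h₁ h₂ h₃ h₄ H₁ H₂ H₃ a b c :=
    CofreeObj.ext (P.comp_assoc i j e₁ e₂ e₃ e₄ h₁ h₂ h₃ h₄ H₁ H₂ H₃ _ _ _) fun w hw => by
      rw [P.cofreeComp_snd (p' := pq - 1) (q' := r - 1) _ e₂ _ _ _ w hw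
          (by omega) (by omega) (by omega) (by omega),
        P.cofreeComp_snd (p' := p - 1) (q' := q - 1) _ e₁ _ _ _ (pq - 1) _
          (by omega) (by omega) (by omega) (by omega),
        P.cofreeComp_snd (p' := p - 1) (q' := qr - 1) _ e₄ _ _ _ w hw
          (by omega) (by omega) (by omega) (by omega),
        P.cofreeComp_snd (p' := q - 1) (q' := r - 1) _ e₃ _ _ _ (qr - 1) _
          (by omega) (by omega) (by omega) (by omega)]
      simp only [cofreeComp_fst, map_add, LinearMap.add_apply, negOnePow_smul_comp,
        comp_negOnePow_smul, smul_add, smul_smul]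
      rw [P.comp_assoc i j e₁ e₂ e₃ e₄ (pq := pq - 1) (qr := qr) (pqr := w) (by omega) (by omega)
          (by omega) (by omega) H₁ H₂ H₃,
        P.comp_assoc i j e₁ e₂ e₃ e₄ (pq := pq - 1) (qr := qr - 1) (pqr := w) (by omega) (by omega)
          (by omega) (by omega) H₁ H₂ H₃,
        P.comp_assoc i j e₁ e₂ e₃ e₄ (pq := pq) (qr := qr - 1) (pqr := w) (by omega) (by omega)
          (by omega) (by omega) H₁ H₂ H₃, ← Int.negOnePow_add, add_assoc]
      -- The only sign left to compare belongs to the term with `ε` in `c`: it is `(-1)^(p + q)` on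
      -- one side and `(-1)^pq` on the other.
      simp only [h₁]
  comp_comm {l m n s t v p q r pq pr pqr} i j hji hij e₁ e₂ e₃ e₄ h₁ h₂ h₃ h₄ H₁ H₂ H₃ a b c :=
    CofreeObj.ext (P.comp_comm i j hji hij e₁ e₂ e₃ e₄ h₁ h₂ h₃ h₄ H₁ H₂ H₃ _ _ _) fun w hw => by
      change _ = (q * r).negOnePow • (P.cofreeComp _ e₄ h₄ (P.cofreeComp j e₃ h₃ a c) b).2 ⟨w, hw⟩
      rw [P.cofreeComp_snd (p' := pq - 1) (q' := r - 1) _ e₂ _ _ _ w hw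
          (by omega) (by omega) (by omega) (by omega),
        P.cofreeComp_snd (p' := p - 1) (q' := q - 1) _ e₁ _ _ _ (pq - 1) _
          (by omega) (by omega) (by omega) (by omega),
        P.cofreeComp_snd (p' := pr - 1) (q' := q - 1) _ e₄ _ _ _ w hw
          (by omega) (by omega) (by omega) (by omega),
        P.cofreeComp_snd (p' := p - 1) (q' := r - 1) _ e₃ _ _ _ (pr - 1) _
          (by omega) (by omega) (by omega) (by omega)]
      simp only [cofreeComp_fst, map_add, LinearMap.add_apply, negOnePow_smul_comp,
        smul_add, smul_smul]
      rw [P.comp_comm i j hji hij e₁ e₂ e₃ e₄ (pq := pq - 1) (pr := pr - 1) (pqr := w) (by omega)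
          (by omega) (by omega) (by omega) H₁ H₂ H₃,
        P.comp_comm i j hji hij e₁ e₂ e₃ e₄ (pq := pq - 1) (pr := pr) (pqr := w) (by omega)
          (by omega) (by omega) (by omega) H₁ H₂ H₃,
        P.comp_comm i j hji hij e₁ e₂ e₃ e₄ (pq := pq) (pr := pr - 1) (pqr := w) (by omega)
          (by omega) (by omega) (by omega) H₁ H₂ H₃]
      -- The sign of the term with `ε` in `b`: moving `c` past an element of degree `q - 1` instead
      -- of `q` changes the sign by `(-1)^r`.
      have hq : p.negOnePow * ((q - 1) * r).negOnePow =
          (q * r).negOnePow * pr.negOnePow := by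
        rw [← Int.negOnePow_add, ← Int.negOnePow_add, Int.negOnePow_eq_iff, ← h₃]
        exact ⟨-r, by ring⟩
      -- The sign of the term with `ε` in `c`; here the two exponents are equal, not merely
      -- congruent.
      have hr : pq.negOnePow * (q * (r - 1)).negOnePow =
          (q * r).negOnePow * p.negOnePow := by
        rw [← Int.negOnePow_add, ← Int.negOnePow_add, Int.negOnePow_eq_iff, ← h₁]
        exact ⟨0, by ring⟩
      simp only [smul_smul]
      rw [hq, hr]
      abel
  d h :=
    { toFun := fun x => (x.2 ⟨_, h⟩, 0)
      map_add' := fun x y => CofreeObj.ext rfl fun _ _ => (add_zero _).symm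
      map_smul' := fun c x => CofreeObj.ext rfl fun _ _ => (smul_zero c).symm }
  d_d h h' x := rfl
  d_act h σ x := CofreeObj.ext rfl fun _ _ => (map_zero _).symm
  d_comp {m n k p q r p' q' r'} i e h hp hq hr h₁ h₂ a b :=
    CofreeObj.ext (P.cofreeComp_snd i e h a b r' hr hp hq h₁ h₂) fun w hw => by
      change 0 = (P.cofreeComp i e h₁ (a.2 ⟨p', hp⟩, 0) b).2 ⟨w, hw⟩ +
        p.negOnePow • (P.cofreeComp i e h₂ a (b.2 ⟨q', hq⟩, 0)).2 ⟨w, hw⟩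
      rw [P.cofreeComp_snd (p' := p' - 1) (q' := q') i e h₁ _ _ w hw (by omega) hq (by omega)
          (by omega),
        P.cofreeComp_snd (p' := p') (q' := q' - 1) i e h₂ _ _ w hw hp (by omega) (by omega)
          (by omega)]
      simp only [Pi.zero_apply, map_zero, LinearMap.zero_apply, zero_add, smul_zero, add_zero]
      -- Both summands have `ε`-coefficient `± a' ∘ᵢ b'`, with signs `(-1)^p'` and `(-1)^p`; they
      -- cancel since `p = p' + 1`, as `∂² = 0` demands.
      have hs : p.negOnePow = -p'.negOnePow := by rw [← hp, Int.negOnePow_succ]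
      rw [hs, Units.neg_smul, add_neg_cancel]

/-! ### The adjunction between forgetting the differential and `P ↦ P[ε]` -/

/-- The coefficient `a` of an element `a + ε a'`. -/
def cofreeFst {P : GradedOperad K} {n : ℕ} {p : ℤ} (x : P.cofree.obj n p) : P.obj n p :=
  Prod.fst (β := ∀ q : {q : ℤ // q + 1 = p}, P.obj n q.1) x

/-- The coefficient `a'` of an element `a + ε a'`. -/
def cofreeSnd {P : GradedOperad K} {n : ℕ} {p q : ℤ} (h : q + 1 = p) (x : P.cofree.obj n p) :
    P.obj n q :=
  Prod.snd (α := P.obj n p) (β := ∀ q : {q : ℤ // q + 1 = p}, P.obj n q.1) x ⟨q, h⟩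

theorem cofree_ext {P : GradedOperad K} {n : ℕ} {p : ℤ} {x y : P.cofree.obj n p}
    (h₁ : cofreeFst x = cofreeFst y)
    (h₂ : ∀ q (h : q + 1 = p), cofreeSnd h x = cofreeSnd h y) : x = y :=
  CofreeObj.ext h₁ h₂

/-- The Leibniz rule applied to `1 ∘ 1 = 1` gives `∂1 = ∂1 + ∂1`. -/
theorem _root_.ChainOperad.d_one (O : ChainOperad K) {q : ℤ} (hq : q + 1 = 0) :
    O.d hq O.one = 0 := by
  have : IsEmpty {x : Fin 1 // x ≠ 0} := ⟨fun x => x.2 (Subsingleton.elim _ _)⟩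
  have h := O.d_comp (p' := q) (q' := q) 0
    (((Equiv.equivOfIsEmpty {x : Fin 1 // x ≠ 0} (Fin 0)).sumCongr (Equiv.refl (Fin 1))).trans
      (Equiv.emptySum _ _)) (zero_add 0) hq hq hq (add_zero q) (zero_add q) O.one O.one
  rw [O.one_comp 0 _ (Equiv.refl _) (fun y => rfl), O.one_comp 0 _ (Equiv.refl _) (fun y => rfl),
    O.comp_one 0 _ (Equiv.refl _) (fun x hx => absurd (Subsingleton.elim x 0) hx) rfl,
    Int.negOnePow_zero, one_smul] at h
  simpa [O.act_refl] using h

/-- Composition of morphisms of graded operads. -/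
def Hom.trans {O P Q : GradedOperad K} (f : Hom O P) (g : Hom P Q) : Hom O Q where
  app n p := (g.app n p).comp (f.app n p)
  map_act σ x := (congrArg _ (f.map_act σ x)).trans (g.map_act σ _)
  map_one := (congrArg _ f.map_one).trans g.map_one
  map_comp i e h a b := (congrArg _ (f.map_comp i e h a b)).trans (g.map_comp i e h _ _)

/-- The counit `P[ε] → P`, `ε ↦ 0`. -/
def cofreeCounit (P : GradedOperad K) : Hom P.cofree.toGradedOperad P where
  app _ _ := LinearMap.fst K _ _
  map_act _ _ := rfl
  map_one := rfl
  map_comp _ _ _ _ _ := rfl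

/-- The morphism of chain operads `O → P[ε]`, `x ↦ f x + ε f (∂x)`, for a morphism of graded
operads `f : O → P`. -/
def cofreeLift {O : ChainOperad K} {P : GradedOperad K} (f : Hom O.toGradedOperad P) :
    O ⟶ P.cofree where
  app n p := LinearMap.prod (f.app n p)
    (LinearMap.pi fun q : {q : ℤ // q + 1 = p} => (f.app n q.1).comp (O.d q.2))
  map_act σ x := cofree_ext (f.map_act σ x) fun q hq =>
    (congrArg (f.app _ q) (O.d_act hq σ x)).trans (f.map_act σ _)
  map_one := cofree_ext f.map_one fun q hq =>
    (congrArg (f.app 1 q) (O.d_one hq)).trans (map_zero _)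
  map_comp {m n k p q r} i e h a b := cofree_ext (f.map_comp i e h a b) fun s hs => by
    refine Eq.trans ?_ (P.cofreeComp_snd (p' := p - 1) (q' := q - 1) i e h _ _ s hs (by omega)
      (by omega) (by omega) (by omega)).symm
    refine (congrArg (f.app k s) (O.d_comp (p' := p - 1) (q' := q - 1) i e h (by omega) (by omega)
      hs (by omega) (by omega) a b)).trans ?_
    refine (map_add _ _ _).trans (congrArg₂ (· + ·) (f.map_comp _ _ _ _ _) ?_)
    exact (map_zsmul (f.app k s) (p.negOnePow : ℤ) _).trans
      (congrArg (p.negOnePow • ·) (f.map_comp _ _ _ _ _))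
  -- The `ε`-coefficients are `f (∂∂x)` and zero.
  map_d h x := cofree_ext rfl fun q hq =>
    (congrArg (f.app _ q) (O.d_d h hq x)).trans (map_zero _)

/-- The `ε`-coefficient of `f x` is the first coefficient of `∂(f x) = f (∂x)`, so the first
coefficients determine a chain morphism. This is the uniqueness half of the adjunction. -/
theorem cofree_hom_ext {O : ChainOperad K} {P : GradedOperad K} {f g : O ⟶ P.cofree}
    (h : ∀ n p x, cofreeFst (f.app n p x) = cofreeFst (g.app n p x)) : f = g := by
  refine ChainOperad.Hom.ext ?_
  funext n p
  refine LinearMap.ext fun x => cofree_ext (h n p x) fun q hq => ?_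
  have hf := congrArg cofreeFst (f.map_d hq x)
  have hg := congrArg cofreeFst (g.map_d hq x)
  exact hf.symm.trans ((h n q _).trans hg)

end GradedOperad

/-! ## The universal property of linking in graded operads -/

/-- The inclusion of the generators of the operad that is linked on. -/
def ChainOperad.linkGen {K : Type u} [Field K] {G : SigmaModule K} {L : ChainOperad K}
    (inP : G.free.ch ⟶ L) : SigmaModule.Hom G L.toSigmaModule where
  app n p := (inP.app n p).comp ((G.free.chOf.app n p).comp (G.freeOf.app n p))
  map_act {m n p} σ x := by
    refine Eq.trans ?_ (inP.map_act σ _)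
    refine congrArg (inP.app n p) (Eq.trans ?_ (G.free.chOf.map_act σ _))
    exact congrArg (G.free.chOf.app n p) (G.freeOf.map_act σ x)

namespace IsUniversalLinking

variable {K : Type u} [Field K] {G : SigmaModule K} {Q L : ChainOperad K}
  {φ : SigmaModule.Hom G.desusp Q.toSigmaModule} {inQ : Q ⟶ L} {inP : G.free.ch ⟶ L}

/-- This is the commutativity of the pushout square, read on the generator `s⁻¹x`. -/
theorem d_linkGen (hL : IsUniversalLinking G.freeOf φ inQ inP) {n : ℕ} {q : ℤ}
    (x : G.obj n (q + 1)) :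
    L.d (q := q) rfl ((ChainOperad.linkGen inP).app n (q + 1) x) = inQ.app n q (φ.app n q x) := by
  have h := congrArg (fun f : G.desusp.free.ch ⟶ L =>
    f.app n q (G.desusp.free.chOf.app n q (G.desusp.freeOf.app n q x))) hL.w
  exact (inP.map_d (q := q) rfl (G.free.chOf.app n (q + 1) (G.freeOf.app n (q + 1) x))).symm.trans
    h.symm

/-- The lifts of `f` and `g` to `P[ε]` are chain morphisms out of a pushout, so they may be compared
on `Q` and on `G`. Nothing beyond `hQ` and `hG` has to be checked, since the `ε`-coefficient at `x`
in `G` is the value at `∂x`, which comes from `Q`. -/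
theorem graded_hom_ext (hL : IsUniversalLinking G.freeOf φ inQ inP) {P : GradedOperad K}
    {f g : GradedOperad.Hom L.toGradedOperad P}
    (hQ : ∀ n p x, f.app n p (inQ.app n p x) = g.app n p (inQ.app n p x))
    (hG : ∀ n p x, f.app n p ((ChainOperad.linkGen inP).app n p x) =
      g.app n p ((ChainOperad.linkGen inP).app n p x)) : f = g := by
  have key : GradedOperad.cofreeLift f = GradedOperad.cofreeLift g := by
    refine hL.hom_ext (GradedOperad.cofree_hom_ext hQ) ?_
    refine GradedOperad.ch_hom_ext fun n p x => ?_
    have h := SigmaModule.free_hom_ext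
      (f := G.free.chOf.trans (inP ≫ GradedOperad.cofreeLift f).toGradedHom)
      (g := G.free.chOf.trans (inP ≫ GradedOperad.cofreeLift g).toGradedHom)
      fun n p x => GradedOperad.cofree_ext (hG n p x) fun q hq => by
        subst hq
        have h := hL.d_linkGen x
        exact (congrArg (f.app n q) h).trans ((hQ n q _).trans (congrArg (g.app n q) h).symm)
    exact congrArg (fun k : GradedOperad.Hom G.free P.cofree.toGradedOperad => k.app n p x) h
  refine GradedOperad.Hom.ext ?_
  funext n p
  refine LinearMap.ext fun x => ?_
  exact congrArg (fun k : L ⟶ P.cofree => GradedOperad.cofreeFst (k.app n p x)) key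

/-- The map `G → P[ε]`, `x ↦ g x + ε f (φ x)`. -/
def cofreeGen (φ : SigmaModule.Hom G.desusp Q.toSigmaModule) {P : GradedOperad K}
    (f : GradedOperad.Hom Q.toGradedOperad P) (g : SigmaModule.Hom G P.toSigmaModule) :
    SigmaModule.Hom G P.cofree.toSigmaModule where
  app n p := LinearMap.prod (g.app n p) (LinearMap.pi fun q : {q : ℤ // q + 1 = p} =>
    -- Substituting `p = q + 1` turns an element of `G` of degree `p` into one of `s⁻¹G` of degree
    -- `q`, to which `φ` applies.
    match p, q with
    | _, ⟨q, rfl⟩ => (f.app n q).comp (φ.app n q))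
  map_act {m n p} σ x := GradedOperad.cofree_ext (g.map_act σ x) fun q hq => by
    subst hq
    exact (congrArg (f.app n q) (φ.map_act σ x)).trans (f.map_act σ _)

/-- The chain morphisms to `P[ε]` given by `x ↦ f x + ε f (∂x)` on `Q` and by `cofreeGen` on `G`
glue over the pushout; setting `ε = 0` afterwards gives the extension. -/
theorem exists_graded_hom (hL : IsUniversalLinking G.freeOf φ inQ inP)
    (hφ : ∀ n p (x : G.desusp.obj n (p + 1)), Q.d (q := p) rfl (φ.app n (p + 1) x) = 0)
    {P : GradedOperad K}
    (f : GradedOperad.Hom Q.toGradedOperad P) (g : SigmaModule.Hom G P.toSigmaModule) :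
    ∃ k : GradedOperad.Hom L.toGradedOperad P,
      (∀ n p x, k.app n p (inQ.app n p x) = f.app n p x) ∧
      ∀ n p x, k.app n p ((ChainOperad.linkGen inP).app n p x) = g.app n p x := by
  have w : ChainOperad.linkAttach φ ≫ GradedOperad.cofreeLift f =
      GradedOperad.linkBoundary G.freeOf ≫
        GradedOperad.chLift (SigmaModule.freeLift (cofreeGen φ f g)) := by
    refine GradedOperad.ch_hom_ext fun n p x => ?_
    have h := SigmaModule.free_hom_ext
      (f := G.desusp.free.chOf.trans
        (ChainOperad.linkAttach φ ≫ GradedOperad.cofreeLift f).toGradedHom)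
      (g := G.desusp.free.chOf.trans (GradedOperad.linkBoundary G.freeOf ≫
        GradedOperad.chLift (SigmaModule.freeLift (cofreeGen φ f g))).toGradedHom)
      -- Both composites have first coefficient `f (φ x)`. The `ε`-coefficients are `f (∂φ x)` and
      -- zero, and here it is essential that `φ x` is a cycle.
      fun n p x => GradedOperad.cofree_ext rfl fun q hq => by
        subst hq
        exact (congrArg (f.app n q) (hφ n q x)).trans (map_zero _)
    exact congrArg (fun k : GradedOperad.Hom G.desusp.free P.cofree.toGradedOperad =>
      k.app n p x) h
  refine ⟨(hL.desc _ _ w).toGradedHom.trans P.cofreeCounit, fun n p x => ?_, fun n p x => ?_⟩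
  · exact congrArg (fun k : Q ⟶ P.cofree => GradedOperad.cofreeFst (k.app n p x))
      (hL.inl_desc _ _ w)
  · exact congrArg (fun k : G.free.ch ⟶ P.cofree => GradedOperad.cofreeFst
      (k.app n p (G.free.chOf.app n p (G.freeOf.app n p x)))) (hL.inr_desc _ _ w)

end IsUniversalLinking

/-! ## Generated suboperads -/

namespace GradedOperad

variable {K : Type u} [Field K]

/-- The elements of given arity and degree of the suboperad generated by `S`. -/
def genSubmodule (O : GradedOperad K) (S : ∀ n p, Set (O.obj n p)) (n : ℕ) (p : ℤ) :
    Submodule K (O.obj n p) where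
  carrier := {x | O.Generated S x}
  add_mem' hx hy := .add _ _ hx hy
  zero_mem' := .zero n p
  smul_mem' c _ hx := .smul c _ hx

theorem negOnePow_smul_coe {V : Type u} [AddCommGroup V] [Module K V] (W : Submodule K V) (a : ℤ)
    (x : W) : ((a.negOnePow • x : W) : V) = a.negOnePow • (x : V) :=
  map_zsmul W.subtype (a.negOnePow : ℤ) x

/-- The suboperad generated by `S`. -/
def genOperad (O : GradedOperad K) (S : ∀ n p, Set (O.obj n p)) : GradedOperad K where
  obj n p := O.genSubmodule S n p
  act σ := (O.act σ).restrict fun x hx => .act σ x hx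
  act_refl x := Subtype.ext (O.act_refl _)
  act_trans σ τ x := Subtype.ext (O.act_trans σ τ _)
  one := ⟨O.one, .one⟩
  comp i e h := LinearMap.mk₂ K (fun a b => ⟨O.comp i e h a.1 b.1, .comp i e h _ _ a.2 b.2⟩)
    (fun _ _ _ => Subtype.ext (LinearMap.map_add₂ _ _ _ _))
    (fun _ _ _ => Subtype.ext (LinearMap.map_smul₂ _ _ _ _))
    (fun _ _ _ => Subtype.ext (map_add _ _ _))
    (fun _ _ _ => Subtype.ext (map_smul _ _ _))
  act_comp i e h τ a b := Subtype.ext (O.act_comp i e h τ _ _)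
  comp_act σ τ i e e' h H₁ H₂ a b := Subtype.ext (O.comp_act σ τ i e e' h H₁ H₂ _ _)
  one_comp i e σ H b := Subtype.ext (O.one_comp i e σ H _)
  comp_one i e σ H H' a := Subtype.ext (O.comp_one i e σ H H' _)
  comp_assoc i j e₁ e₂ e₃ e₄ h₁ h₂ h₃ h₄ H₁ H₂ H₃ a b c :=
    Subtype.ext (O.comp_assoc i j e₁ e₂ e₃ e₄ h₁ h₂ h₃ h₄ H₁ H₂ H₃ _ _ _)
  comp_comm i j hji hij e₁ e₂ e₃ e₄ h₁ h₂ h₃ h₄ H₁ H₂ H₃ a b c :=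
    Subtype.ext <| by
      rw [negOnePow_smul_coe]
      exact O.comp_comm i j hji hij e₁ e₂ e₃ e₄ h₁ h₂ h₃ h₄ H₁ H₂ H₃ _ _ _

/-- The inclusion of the suboperad generated by `S`. -/
def genIncl (O : GradedOperad K) (S : ∀ n p, Set (O.obj n p)) : Hom (O.genOperad S) O where
  app n p := (O.genSubmodule S n p).subtype
  map_act _ _ := rfl
  map_one := rfl
  map_comp _ _ _ _ _ := rfl

/-- A morphism of `Σ`-modules with values in a generated suboperad. -/
def _root_.SigmaModule.Hom.genCod {O : GradedOperad K} {S : ∀ n p, Set (O.obj n p)}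
    {M : SigmaModule K} (f : SigmaModule.Hom M O.toSigmaModule)
    (h : ∀ n p x, O.Generated S (f.app n p x)) :
    SigmaModule.Hom M (O.genOperad S).toSigmaModule where
  app n p := (f.app n p).codRestrict (O.genSubmodule S n p) (h n p)
  map_act σ x := Subtype.ext (f.map_act σ x)

/-- A morphism of graded operads with values in a generated suboperad. -/
def Hom.genCod {N O : GradedOperad K} {S : ∀ n p, Set (O.obj n p)}
    (f : Hom N O) (h : ∀ n p x, O.Generated S (f.app n p x)) : Hom N (O.genOperad S) where
  toSigmaHom := f.toSigmaHom.genCod h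
  map_one := Subtype.ext f.map_one
  map_comp i e h a b := Subtype.ext (f.map_comp i e h a b)

/-- The identity morphism. -/
def Hom.refl (O : GradedOperad K) : Hom O O where
  app _ _ := LinearMap.id
  map_act _ _ := rfl
  map_one := rfl
  map_comp _ _ _ _ _ := rfl

theorem Generated.map {O P : GradedOperad K} (f : Hom O P) {S : ∀ n p, Set (O.obj n p)}
    {T : ∀ n p, Set (P.obj n p)} (hf : ∀ n p, ∀ x ∈ S n p, P.Generated T (f.app n p x))
    {n : ℕ} {p : ℤ} {x : O.obj n p} (hx : O.Generated S x) : P.Generated T (f.app n p x) := by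
  induction hx with
  | gen x hx => exact hf _ _ x hx
  | one => rw [f.map_one]; exact .one
  | zero n p => rw [map_zero]; exact .zero n p
  | add x y _ _ hx hy => rw [map_add]; exact .add _ _ hx hy
  | smul c x _ hx => rw [map_smul]; exact .smul c _ hx
  | act σ x _ hx => rw [f.map_act]; exact .act σ _ hx
  | comp i e h a b _ _ ha hb => rw [f.map_comp]; exact .comp i e h _ _ ha hb

theorem Generated.mono {O : GradedOperad K} {S T : ∀ n p, Set (O.obj n p)}
    (h : ∀ n p, S n p ⊆ T n p) {n : ℕ} {p : ℤ} {x : O.obj n p} (hx : O.Generated S x) :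
    O.Generated T x :=
  hx.map (Hom.refl O) fun n p x hx => .gen x (h n p hx)

/-- The generators lift to the suboperad that they generate, and the resulting endomorphism of the
free operad fixes them. So it is the identity, and every element lies in the suboperad. -/
theorem generated_free (M : SigmaModule K) {n : ℕ} {p : ℤ} (x : M.free.obj n p) :
    M.free.Generated (fun n p => Set.range (M.freeOf.app n p)) x := by
  have h := SigmaModule.free_hom_ext (g := Hom.refl M.free)
    (f := (SigmaModule.freeLift (M.freeOf.genCod
      (S := fun n p => Set.range (M.freeOf.app n p)) fun n p x => .gen _ ⟨x, rfl⟩)).trans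
        (M.free.genIncl _)) fun _ _ _ => rfl
  have hx : _ = x := congrArg (fun f : Hom M.free M.free => f.app n p x) h
  rw [← hx]
  exact Subtype.prop (p := M.free.Generated _) _

/-- As for free operads: the universal property yields a morphism from `L` to the suboperad which,
followed by the inclusion, is the identity by uniqueness. -/
theorem generated_linking {G : SigmaModule K} {Q L : ChainOperad K}
    {φ : SigmaModule.Hom G.desusp Q.toSigmaModule} {inQ : Q ⟶ L} {inP : G.free.ch ⟶ L}
    (hL : IsUniversalLinking G.freeOf φ inQ inP)
    (hφ : ∀ n p (x : G.desusp.obj n (p + 1)), Q.d (q := p) rfl (φ.app n (p + 1) x) = 0)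
    {n : ℕ} {p : ℤ} (x : L.obj n p) :
    L.toGradedOperad.Generated (fun n p => Set.range (inQ.app n p) ∪
      Set.range ((ChainOperad.linkGen inP).app n p)) x := by
  obtain ⟨k, hkQ, hkG⟩ := hL.exists_graded_hom hφ
    (inQ.toGradedHom.genCod (S := fun n p => Set.range (inQ.app n p) ∪
      Set.range ((ChainOperad.linkGen inP).app n p)) fun n p x => .gen _ (.inl ⟨x, rfl⟩))
    ((ChainOperad.linkGen inP).genCod fun n p x => .gen _ (.inr ⟨x, rfl⟩))
  have h := hL.graded_hom_ext (g := Hom.refl L.toGradedOperad)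
    (f := k.trans (L.toGradedOperad.genIncl _))
    (fun n p x => congrArg Subtype.val (hkQ n p x)) (fun n p x => congrArg Subtype.val (hkG n p x))
  have hx : _ = x := congrArg (fun f : Hom L.toGradedOperad L.toGradedOperad => f.app n p x) h
  rw [← hx]
  exact Subtype.prop (p := L.toGradedOperad.Generated _) _

/-! ## Weights of elements of large arity -/

/-- A composite loses the input that is filled. The additive form avoids truncated subtraction. -/
theorem card_of_comp {m n k : ℕ} {i : Fin m} (e : {x : Fin m // x ≠ i} ⊕ Fin n ≃ Fin k) :
    k + 1 = m + n := by
  have h := Fintype.card_congr e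
  simp only [Fintype.card_sum, Fintype.card_subtype_compl, Fintype.card_fin,
    Fintype.card_unique, ne_eq] at h
  have := i.pos
  omega

/-- If there are no generators of arity at least `N`, then the elements of arity at least `N` other
than one are decomposable. -/
theorem Generated.weightGE {O : GradedOperad K} {S S' : ∀ n p, Set (O.obj n p)}
    (hSS' : ∀ n p, S n p ⊆ S' n p) {N : ℕ} (hS : ∀ n p, N ≤ n → ∀ x ∈ S n p, x = 0)
    {n : ℕ} {p : ℤ} {x : O.obj n p} (hx : O.Generated S x) :
    O.WeightGE S' 0 x ∧ (n ≠ 1 → O.WeightGE S' 1 x) ∧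
      (N ≤ n → n ≠ 1 → O.WeightGE S' 2 x) := by
  induction hx with
  | @gen n p x hx =>
    have h₁ := WeightGE.gen x (hSS' _ _ hx)
    refine ⟨.mono zero_le_one _ h₁, fun _ => h₁, fun hn _ => ?_⟩
    rw [hS _ _ hn x hx]
    exact .zero _ _ _
  | one => exact ⟨.one, fun h => absurd rfl h, fun _ h => absurd rfl h⟩
  | zero n p => exact ⟨.zero _ _ _, fun _ => .zero _ _ _, fun _ _ => .zero _ _ _⟩
  | add x y _ _ hx hy =>
    exact ⟨.add _ _ hx.1 hy.1, fun h => .add _ _ (hx.2.1 h) (hy.2.1 h),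
      fun h h' => .add _ _ (hx.2.2 h h') (hy.2.2 h h')⟩
  | smul c x _ hx =>
    exact ⟨.smul _ _ hx.1, fun h => .smul _ _ (hx.2.1 h), fun h h' => .smul _ _ (hx.2.2 h h')⟩
  | act σ x _ hx =>
    obtain rfl := Fin.equiv_iff_eq.mp ⟨σ⟩
    exact ⟨.act _ _ hx.1, fun h => .act _ _ (hx.2.1 h), fun h h' => .act _ _ (hx.2.2 h h')⟩
  | @comp m n k p q r i e h a b _ _ ha hb =>
    -- If one factor has arity one, the other has the arity of the composite and already carries the
    -- whole weight. Otherwise each factor contributes weight at least one; this includes factors of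
    -- arity zero.
    have hk := card_of_comp e
    refine ⟨.comp i e h a b ha.1 hb.1, fun h₁ => ?_, fun hN h₁ => ?_⟩
    · by_cases hm : m = 1
      · exact .comp (v := 0) (w := 1) i e h a b ha.1 (hb.2.1 (by omega))
      · exact .comp (v := 1) (w := 0) i e h a b (ha.2.1 hm) hb.1
    · by_cases hm : m = 1
      · exact .comp (v := 0) (w := 2) i e h a b ha.1 (hb.2.2 (by omega) (by omega))
      · by_cases hn : n = 1
        · exact .comp (v := 2) (w := 0) i e h a b (ha.2.2 (by omega) hm) hb.1
        · exact .comp (v := 1) (w := 1) i e h a b (ha.2.1 hm) (hb.2.1 hn)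

/-! ### Scalar elements -/

/-- The multiples of the operadic identity, and zero in other arities and degrees. -/
inductive IsScalar (O : GradedOperad K) : ∀ {n : ℕ} {p : ℤ}, O.obj n p → Prop
  | zero (n : ℕ) (p : ℤ) : IsScalar O (0 : O.obj n p)
  | smul_one (c : K) : IsScalar O (c • O.one)

theorem IsScalar.add {O : GradedOperad K} {n : ℕ} {p : ℤ} {x y : O.obj n p} (hx : O.IsScalar x)
    (hy : O.IsScalar y) : O.IsScalar (x + y) := by
  cases hx with
  | zero => rwa [zero_add]
  | smul_one c =>
    cases hy with
    | zero => rw [add_zero]; exact .smul_one c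
    | smul_one c' => rw [← add_smul]; exact .smul_one _

theorem IsScalar.smul {O : GradedOperad K} {n : ℕ} {p : ℤ} {x : O.obj n p} (c : K)
    (hx : O.IsScalar x) : O.IsScalar (c • x) := by
  cases hx with
  | zero => rw [smul_zero]; exact .zero _ _
  | smul_one c => rw [smul_smul]; exact .smul_one _

theorem IsScalar.act {O : GradedOperad K} {m n : ℕ} {p : ℤ} {x : O.obj m p} (σ : Fin m ≃ Fin n)
    (hx : O.IsScalar x) : O.IsScalar (O.act σ x) := by
  obtain rfl := Fin.equiv_iff_eq.mp ⟨σ⟩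
  cases hx with
  | zero => rw [map_zero]; exact .zero _ _
  | smul_one c =>
    rw [Subsingleton.elim σ (Equiv.refl _), O.act_refl]
    exact .smul_one _

theorem IsScalar.map {O P : GradedOperad K} (f : Hom O P) {n : ℕ} {p : ℤ} {x : O.obj n p}
    (hx : O.IsScalar x) : P.IsScalar (f.app n p x) := by
  cases hx with
  | zero => rw [map_zero]; exact .zero _ _
  | smul_one c => rw [map_smul, f.map_one]; exact .smul_one _

/-- If all generators of positive arity are scalar, then so are all elements of positive arity. -/
theorem Generated.isScalar {O : GradedOperad K} {S : ∀ n p, Set (O.obj n p)}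
    (hS : ∀ n p, 0 < n → ∀ x ∈ S n p, O.IsScalar x)
    {n : ℕ} {p : ℤ} {x : O.obj n p} (hx : O.Generated S x) (hn : 0 < n) : O.IsScalar x := by
  induction hx with
  | gen x hx => exact hS _ _ hn x hx
  | one => rw [← one_smul K O.one]; exact .smul_one 1
  | zero n p => exact .zero _ _
  | add x y _ _ hx hy => exact (hx hn).add (hy hn)
  | smul c x _ hx => exact (hx hn).smul c
  | act σ x _ hx =>
    obtain rfl := Fin.equiv_iff_eq.mp ⟨σ⟩
    exact (hx hn).act σ
  | @comp m n k p q r i e h a b _ _ ha hb =>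
    have hk := card_of_comp e
    -- The factor `a` has an input `i`, so it is scalar by induction. If it is `c • 1`, then `b` has
    -- the arity of the composite, which is positive, and is scalar too.
    cases ha i.pos with
    | zero => rw [zero_comp]; exact .zero _ _
    | smul_one c =>
      obtain rfl : n = k := by omega
      obtain rfl : q = r := by omega
      -- The only input of the identity is filled, so `e` restricted to the inputs of `b` is an
      -- injection of `Fin n` into itself, hence the renumbering required by the unit law.
      have he : ∀ y, e (Sum.inr y) = (Equiv.ofBijective (fun y => e (Sum.inr y))
          (Finite.injective_iff_bijective.mp (e.injective.comp Sum.inr_injective))) y :=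
        fun y => rfl
      rw [map_smul, LinearMap.smul_apply, O.one_comp i e _ he]
      exact ((hb hn).act _).smul c

end GradedOperad

/-! ## The universal property of link operads in graded operads -/

/-- Composition of morphisms of graded `Σ`-modules. -/
def SigmaModule.Hom.trans {K : Type u} [Field K] {M N P : SigmaModule K}
    (f : SigmaModule.Hom M N) (g : SigmaModule.Hom N P) : SigmaModule.Hom M P where
  app n p := (g.app n p).comp (f.app n p)
  map_act σ x := (congrArg _ (f.map_act σ x)).trans (g.map_act σ _)

/-- The inclusion of a summand in a direct sum of graded `Σ`-modules. -/
noncomputable def SigmaModule.directSumOf {K : Type u} [Field K] (E : ℕ → SigmaModule K) (k : ℕ) :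
    SigmaModule.Hom (E k) (SigmaModule.directSum E) where
  app n p := DirectSum.lof K ℕ (fun k => (E k).obj n p) k
  map_act σ x := (DirectSum.lmap_lof (R := K) (fun k => (E k).act σ) k x).symm

theorem SigmaModule.Hom.desc_directSumOf {K : Type u} [Field K] {E : ℕ → SigmaModule K}
    {N : SigmaModule K} (ι : ∀ k, SigmaModule.Hom (E k) N) (k : ℕ) {n : ℕ} {p : ℤ}
    (x : (E k).obj n p) :
    (SigmaModule.Hom.desc ι).app n p ((SigmaModule.directSumOf E k).app n p x) =
      (ι k).app n p x :=
  DirectSum.toModule_lof (φ := fun k => (ι k).app n p) K k x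

namespace LinkTower

variable {K : Type u} [Field K] {M : ℕ → SigmaModule K} (T : LinkTower M)

/-- The inclusion of `M j` in the stage of the tower in which it is linked on. -/
def gen : ∀ j : ℕ, SigmaModule.Hom (M j) (T.stage j).toSigmaModule
  | 0 => (M 0).freeOf.trans T.base.inv.toSigmaHom
  | j + 1 => ChainOperad.linkGen (T.cell j)

theorem d_gen_zero {n : ℕ} {q : ℤ} (x : (M 0).obj n (q + 1)) :
    (T.stage 0).d (q := q) rfl ((T.gen 0).app n (q + 1) x) = 0 :=
  (T.base.inv.map_d (q := q) rfl ((M 0).freeOf.app n (q + 1) x)).symm.trans (map_zero _)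

theorem d_gen_succ (j : ℕ) {n : ℕ} {q : ℤ} (x : (M (j + 1)).obj n (q + 1)) :
    (T.stage (j + 1)).d (q := q) rfl ((T.gen (j + 1)).app n (q + 1) x) =
      (T.incl j).app n q ((T.φ j).app n q x) :=
  (T.isUniversalLinking j).d_linkGen x

theorem base_inv_hom {n : ℕ} {p : ℤ} (x : (T.stage 0).obj n p) :
    T.base.inv.app n p (T.base.hom.app n p x) = x :=
  congrArg (fun f : T.stage 0 ⟶ T.stage 0 => f.app n p x) T.base.hom_inv_id

theorem base_hom_inv {n : ℕ} {p : ℤ} (x : (M 0).free.obj n p) :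
    T.base.hom.app n p (T.base.inv.app n p x) = x :=
  congrArg (fun f : (M 0).free.toChain ⟶ (M 0).free.toChain => f.app n p x) T.base.inv_hom_id

theorem stage_zero_hom_ext {P : GradedOperad K}
    {f g : GradedOperad.Hom (T.stage 0).toGradedOperad P}
    (h : ∀ n p x, f.app n p ((T.gen 0).app n p x) = g.app n p ((T.gen 0).app n p x)) : f = g := by
  have key := SigmaModule.free_hom_ext (f := T.base.inv.toGradedHom.trans f)
    (g := T.base.inv.toGradedHom.trans g) h
  refine GradedOperad.Hom.ext ?_
  funext n p
  refine LinearMap.ext fun x => ?_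
  have hx := congrArg (fun k : GradedOperad.Hom (M 0).free P =>
    k.app n p (T.base.hom.app n p x)) key
  rw [← T.base_inv_hom x]
  exact hx

theorem generated_stage_zero {n : ℕ} {p : ℤ} (x : (T.stage 0).obj n p) :
    (T.stage 0).toGradedOperad.Generated (fun n p => Set.range ((T.gen 0).app n p)) x := by
  rw [← T.base_inv_hom x]
  refine GradedOperad.Generated.map (O := (M 0).free) T.base.inv.toGradedHom ?_
    (GradedOperad.generated_free (M 0) _)
  rintro n p _ ⟨y, rfl⟩
  exact .gen _ ⟨y, rfl⟩

/-- All linking maps take values in cycles. -/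
def HasCycles : Prop :=
  ∀ (j n : ℕ) (p : ℤ) (x : (M (j + 1)).desusp.obj n (p + 1)),
    (T.stage j).d (q := p) rfl ((T.φ j).app n (p + 1) x) = 0

variable {T}

/-- By recursion along the tower: stage zero is free, and each linking step extends the morphism
already chosen. -/
theorem exists_stage_homs (hT : T.HasCycles) {P : GradedOperad K}
    (g : ∀ j, SigmaModule.Hom (M j) P.toSigmaModule) :
    ∃ f : ∀ j, GradedOperad.Hom (T.stage j).toGradedOperad P,
      (∀ j n p x, (f (j + 1)).app n p ((T.incl j).app n p x) = (f j).app n p x) ∧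
      ∀ j n p x, (f j).app n p ((T.gen j).app n p x) = (g j).app n p x := by
  choose step hstep using fun j (f : GradedOperad.Hom (T.stage j).toGradedOperad P) =>
    (T.isUniversalLinking j).exists_graded_hom (hT j) f (g (j + 1))
  let f : ∀ j, GradedOperad.Hom (T.stage j).toGradedOperad P := fun j =>
    Nat.rec (GradedOperad.Hom.trans (P := (M 0).free) T.base.hom.toGradedHom
      (SigmaModule.freeLift (g 0))) step j
  refine ⟨f, fun j => (hstep j (f j)).1, fun j => ?_⟩
  cases j with
  | zero =>
    intro n p x
    exact congrArg ((SigmaModule.freeLift (g 0)).app n p) (T.base_hom_inv _)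
  | succ j => exact (hstep j (f j)).2

variable (L : Cocone (Functor.ofSequence T.incl))

/-- The morphism from a stage of the tower to the colimit. -/
def toColimit (j : ℕ) : T.stage j ⟶ L.pt := L.ι.app j

theorem incl_toColimit (j : ℕ) : T.incl j ≫ toColimit L (j + 1) = toColimit L j := by
  have h := L.w (homOfLE (Nat.le_add_right j 1))
  rwa [Functor.ofSequence_map_homOfLE_succ] at h

theorem toColimit_incl (j : ℕ) {n : ℕ} {p : ℤ} (x : (T.stage j).obj n p) :
    (toColimit L (j + 1)).app n p ((T.incl j).app n p x) = (toColimit L j).app n p x :=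
  congrArg (fun f : T.stage j ⟶ L.pt => f.app n p x) (incl_toColimit L j)

/-- The inclusion of `M j` in the link operad. -/
def genColimit (j : ℕ) : SigmaModule.Hom (M j) L.pt.toSigmaModule :=
  (T.gen j).trans (toColimit L j).toSigmaHom

variable {L}

/-- Agreement climbs the tower one linking step at a time. The lifts to `P[ε]` then agree on every
stage, hence on the colimit of chain operads. -/
theorem colimit_graded_hom_ext (hL : IsColimit L) {P : GradedOperad K}
    {f g : GradedOperad.Hom L.pt.toGradedOperad P}
    (h : ∀ j n p x, f.app n p ((genColimit L j).app n p x) =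
      g.app n p ((genColimit L j).app n p x)) : f = g := by
  have hstage : ∀ j, (toColimit L j).toGradedHom.trans f = (toColimit L j).toGradedHom.trans g := by
    intro j
    induction j with
    | zero => exact T.stage_zero_hom_ext (h 0)
    | succ j ih =>
      refine (T.isUniversalLinking j).graded_hom_ext (fun n p x => ?_) (h (j + 1))
      have hx := congrArg
        (fun k : GradedOperad.Hom (T.stage j).toGradedOperad P => k.app n p x) ih
      have hi := toColimit_incl L j x
      exact (congrArg (f.app n p) hi).trans (hx.trans (congrArg (g.app n p) hi).symm)
  have key : GradedOperad.cofreeLift f = GradedOperad.cofreeLift g :=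
    hL.hom_ext fun j => GradedOperad.cofree_hom_ext fun n p x =>
      congrArg (fun k : GradedOperad.Hom (T.stage j).toGradedOperad P => k.app n p x) (hstage j)
  refine GradedOperad.Hom.ext ?_
  funext n p
  refine LinearMap.ext fun x => ?_
  exact congrArg (fun k : L.pt ⟶ P.cofree => GradedOperad.cofreeFst (k.app n p x)) key

/-- The compatible graded morphisms on the stages lift to a cocone of chain morphisms with vertex
`P[ε]`; the induced morphism is followed by `ε ↦ 0`. -/
theorem exists_colimit_graded_hom (hT : T.HasCycles) (hL : IsColimit L) {P : GradedOperad K}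
    (g : ∀ j, SigmaModule.Hom (M j) P.toSigmaModule) :
    ∃ f : GradedOperad.Hom L.pt.toGradedOperad P,
      ∀ j n p x, f.app n p ((genColimit L j).app n p x) = (g j).app n p x := by
  obtain ⟨f, hf, hfg⟩ := exists_stage_homs hT g
  let c : Cocone (Functor.ofSequence T.incl) :=
    { pt := P.cofree
      ι := NatTrans.ofSequence (fun j => GradedOperad.cofreeLift (f j)) fun j => by
        rw [Functor.ofSequence_map_homOfLE_succ]
        exact GradedOperad.cofree_hom_ext (hf j) }
  refine ⟨(hL.desc c).toGradedHom.trans P.cofreeCounit, fun j n p x => (Eq.trans ?_ (hfg j n p x))⟩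
  exact congrArg (fun k : T.stage j ⟶ P.cofree =>
    GradedOperad.cofreeFst (k.app n p ((T.gen j).app n p x))) (hL.fac c j)

/-- As a graded operad, the link operad is free on the direct sum of the `M j`. -/
theorem bijective_freeLift (hT : T.HasCycles) (hL : IsColimit L) (n : ℕ) (p : ℤ) :
    Function.Bijective ((SigmaModule.freeLift (O := L.pt.toGradedOperad)
      (SigmaModule.Hom.desc (genColimit L))).app n p) := by
  set F := SigmaModule.freeLift (O := L.pt.toGradedOperad)
    (SigmaModule.Hom.desc (genColimit L))
  -- The inverse is the morphism that sends each `M j` back to the free generators; both composites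
  -- fix generators.
  obtain ⟨G, hG⟩ := exists_colimit_graded_hom hT hL fun j =>
    (SigmaModule.directSumOf M j).trans (SigmaModule.directSum M).freeOf
  have hGF : F.trans G = GradedOperad.Hom.refl _ := by
    refine SigmaModule.free_hom_ext fun n p x => ?_
    have hlin : (G.app n p).comp ((SigmaModule.Hom.desc (genColimit L)).app n p) =
        (SigmaModule.directSum M).freeOf.app n p :=
      DirectSum.linearMap_ext K fun j => LinearMap.ext fun y =>
        (congrArg (G.app n p) (SigmaModule.Hom.desc_directSumOf (genColimit L) j y)).trans (hG j n p y)
    exact LinearMap.congr_fun hlin x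
  have hFG : G.trans F = GradedOperad.Hom.refl _ :=
    colimit_graded_hom_ext hL fun j n p x =>
      (congrArg (F.app n p) (hG j n p x)).trans (SigmaModule.Hom.desc_directSumOf (genColimit L) j x)
  refine Function.bijective_iff_has_inverse.mpr ⟨G.app n p, fun x => ?_, fun x => ?_⟩
  · exact congrArg (fun k : GradedOperad.Hom (SigmaModule.directSum M).free
      (SigmaModule.directSum M).free => k.app n p x) hGF
  · exact congrArg (fun k : GradedOperad.Hom L.pt.toGradedOperad L.pt.toGradedOperad =>
      k.app n p x) hFG

/-! ### Generators and scalar elements of the stages -/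

/-- The stage `j` is generated by the `M i` with `i ≤ j`. -/
theorem generated_toColimit (hT : T.HasCycles) (j : ℕ) {n : ℕ} {p : ℤ} (x : (T.stage j).obj n p) :
    L.pt.toGradedOperad.Generated
      (fun n p => {y | ∃ i < j + 1, y ∈ Set.range ((genColimit L i).app n p)})
      ((toColimit L j).app n p x) := by
  induction j generalizing n p with
  | zero =>
    refine (T.generated_stage_zero x).map (toColimit L 0).toGradedHom ?_
    rintro n p _ ⟨y, rfl⟩
    exact .gen _ ⟨0, zero_lt_one, y, rfl⟩
  | succ j ih =>
    refine (GradedOperad.generated_linking (T.isUniversalLinking j) (hT j) x).map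
      (toColimit L (j + 1)).toGradedHom ?_
    rintro n p _ (⟨y, rfl⟩ | ⟨y, rfl⟩)
    · have h : (toColimit L (j + 1)).app n p ((T.incl j).app n p y) = _ := toColimit_incl L j y
      refine (congrArg _ h).mpr ((ih y).mono ?_)
      rintro n p _ ⟨i, hi, hy⟩
      exact ⟨i, hi.trans (Nat.lt_succ_self _), hy⟩
    · exact .gen _ ⟨j + 1, Nat.lt_succ_self _, y, rfl⟩

/-- If `M 0, …, M j` are concentrated in arity zero, then all elements of positive arity of the
stage `j` are scalar. -/
theorem isScalar_stage (hT : T.HasCycles) (j : ℕ)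
    (hM : ∀ i ≤ j, ∀ n p, 0 < n → Subsingleton ((M i).obj n p)) {n : ℕ} {p : ℤ} (hn : 0 < n)
    (x : (T.stage j).obj n p) : (T.stage j).IsScalar x := by
  have hgen : ∀ i ≤ j, ∀ n p, 0 < n → ∀ y, (T.stage i).IsScalar ((T.gen i).app n p y) := by
    intro i hi n p hn y
    have := hM i hi n p hn
    rw [Subsingleton.elim y 0, map_zero]
    exact .zero _ _
  induction j generalizing n p with
  | zero =>
    refine (T.generated_stage_zero x).isScalar ?_ hn
    rintro n p hn _ ⟨y, rfl⟩
    exact hgen 0 le_rfl n p hn y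
  | succ j ih =>
    refine (GradedOperad.generated_linking (T.isUniversalLinking j) (hT j) x).isScalar ?_ hn
    rintro n p hn _ (⟨y, rfl⟩ | ⟨y, rfl⟩)
    · exact (ih (fun i hi => hM i (hi.trans j.le_succ)) hn y fun i hi =>
        hgen i (hi.trans j.le_succ)).map (T.incl j).toGradedHom
    · exact hgen (j + 1) le_rfl n p hn y

/-- The value is a multiple `c • 1` of the identity; for `c ≠ 0` the element `c⁻¹ • x` would be sent
to the identity itself. -/
theorem φ_arity_one (hT : T.HasCycles) (j : ℕ)
    (hunit : ∀ x : (M (j + 1)).desusp.obj 1 0, (T.φ j).app 1 0 x ≠ (T.stage j).one)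
    (hM : ∀ i ≤ j, ∀ n p, 0 < n → Subsingleton ((M i).obj n p)) {p : ℤ}
    (x : (M (j + 1)).desusp.obj 1 p) : (T.φ j).app 1 p x = 0 := by
  have h := isScalar_stage hT j hM one_pos ((T.φ j).app 1 p x)
  -- With a variable in place of the value, the case analysis can force `p = 0` in the scalar case.
  generalize hy : (T.φ j).app 1 p x = y at h
  cases h with
  | zero => rfl
  | smul_one c =>
    by_cases hc : c = 0
    · rw [hc, zero_smul]
    · refine absurd ?_ (hunit (c⁻¹ • x))
      rw [map_smul, hy, smul_smul, inv_mul_cancel₀ hc, one_smul]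

end LinkTower

/-! ### Minimality of the link operad -/

theorem proposition4p2 {K : Type u} [Field K] (M : ℕ → SigmaModule K) (T : LinkTower M)
    (hcycle : ∀ (j n : ℕ) (p : ℤ) (x : (M (j + 1)).desusp.obj n (p + 1)),
      (T.stage j).d (q := p) rfl ((T.φ j).app n (p + 1) x) = 0)
    (hunit : ∀ (j : ℕ) (x : (M (j + 1)).desusp.obj 1 0), (T.φ j).app 1 0 x ≠ (T.stage j).one)
    (harity : ∀ i j : ℕ, i < j → ∀ a ∈ (M i).arities, ∀ b ∈ (M j).arities, a < b)
    (L : Cocone (Functor.ofSequence T.incl)) (hL : IsColimit L) :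
    L.pt.IsMinimal := by
  have hd₀ : ∀ (n : ℕ) (p : ℤ) (x : (M 0).obj n (p + 1)),
      L.pt.d (q := p) rfl ((LinkTower.genColimit L 0).app n (p + 1) x) = 0 := fun n p x =>
    ((LinkTower.toColimit L 0).map_d (q := p) rfl _).symm.trans
      ((congrArg _ (T.d_gen_zero x)).trans (map_zero _))
  have hd : ∀ (j n : ℕ) (p : ℤ) (x : (M (j + 1)).obj n (p + 1)),
      L.pt.d (q := p) rfl ((LinkTower.genColimit L (j + 1)).app n (p + 1) x) =
        (LinkTower.toColimit L j).app n p ((T.φ j).app n p x) := fun j n p x =>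
    ((LinkTower.toColimit L (j + 1)).map_d (q := p) rfl _).symm.trans
      ((congrArg _ (T.d_gen_succ j x)).trans (LinkTower.toColimit_incl L j _))
  refine ⟨M, LinkTower.genColimit L, LinkTower.bijective_freeLift hcycle hL, ?_, ?_⟩
  · rintro (_ | j) n p x
    · rw [hd₀]
      exact .zero _ _ _
    · by_cases hx : x = 0
      · rw [hx, map_zero, map_zero]
        exact .zero _ _ _
      -- A nonzero `x` makes `n` an arity of `M (j + 1)`, so the arity hypothesis bounds all earlier
      -- generators.
      · have hn : n ∈ (M (j + 1)).arities := ⟨p + 1, ⟨x, 0, hx⟩⟩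
        have hM : ∀ i < j + 1, ∀ (m : ℕ) (q : ℤ), n ≤ m → Subsingleton ((M i).obj m q) := by
          intro i hi m q hm
          by_contra h
          have := harity i (j + 1) hi m ⟨q, not_subsingleton_iff_nontrivial.mp h⟩ n hn
          omega
        rw [hd]
        -- Arity one is exceptional, because the identity has arity one and weight zero. There `n ≤
        -- m` reads `0 < m`: the earlier modules are concentrated in arity zero.
        by_cases h₁ : n = 1
        · subst h₁
          rw [LinkTower.φ_arity_one hcycle j (hunit j)
            (fun i hi => hM i (Nat.lt_succ_of_le hi)) x, map_zero]
          exact .zero _ _ _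
        -- The threshold is `N = n`, the arity of `x`: all generators of stage `j` vanish from there
        -- on.
        · refine ((LinkTower.generated_toColimit hcycle j _).weightGE ?_ (N := n) ?_).2.2 le_rfl h₁
          · rintro m q _ ⟨i, -, y, rfl⟩
            exact ⟨(SigmaModule.directSumOf M i).app m q y, SigmaModule.Hom.desc_directSumOf _ i y⟩
          · rintro m q hm _ ⟨i, hi, y, rfl⟩
            have := hM i hi m q hm
            rw [Subsingleton.elim y 0, map_zero]
  · rintro (_ | j) n p x
    · rw [hd₀]
      exact .zero _ _
    · rw [hd]
      exact LinkTower.generated_toColimit hcycle j _
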